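/- Let $\mathrm{Pr}=\{p_1,p_2,\dots\}$ be an infinite supply of primitive types. The set of types is the smallest set containing $\mathrm{Pr}$ and containing $A\backslash B$, $B/A$, $A\bullet B$, $\Diamond A$ and $\Box^{\downarrow}A$ whenever it contains $A$ and $B$. Type trees and type hedges are defined simultaneously: every type is a type tree; if $\Gamma$ is a type hedge, then $\langle\Gamma\rangle$ is a type tree; a type hedge is a finite (possibly empty) sequence of type trees. Hedges are concatenated by juxtaposition. The yield of a hedge is the string of types that remains after all angle brackets are removed. A context $\Gamma[\,\cdot\,]$ is a hedge with exactly one leaf replaced by a hole, and $\Gamma[\Delta]$ denotes the hedge obtained by filling the hole with the hedge $\Delta$. A sequent $\Gamma\Rightarrow A$ consists of a hedge $\Gamma$ and a type $A$. A sequent is provable in the Lambek calculus with brackets $\mathbf{L}\Diamond$ if it can be derived from the initial sequents $p_i\Rightarrow p_i$ by the following rules: - $(\backslash\Rightarrow)$: from $\Gamma\Rightarrow A$ and $\Delta[B]\Rightarrow C$ infer $\Delta[\Gamma\; A\backslash B]\Rightarrow C$; - $(\Rightarrow\backslash)$: from $A\;\Pi\Rightarrow B$ with $\Pi$ nonempty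 infer $\Pi\Rightarrow A\backslash B$; - $(/\Rightarrow)$: from $\Gamma\Rightarrow A$ and $\Delta[B]\Rightarrow C$ infer $\Delta[B/A\;\Gamma]\Rightarrow C$; - $(\Rightarrow/)$: from $\Pi\;A\Rightarrow B$ with $\Pi$ nonempty infer $\Pi\Rightarrow B/A$; - $(\bullet\Rightarrow)$: from $\Gamma[A\;B]\Rightarrow C$ infer $\Gamma[A\bullet B]\Rightarrow C$; - $(\Rightarrow\bullet)$: from $\Gamma\Rightarrow A$ and $\Delta\Rightarrow B$ infer $\Gamma\;\Delta\Rightarrow A\bullet B$; - $(\Diamond\Rightarrow)$: from $\Gamma[\langle A\rangle]\Rightarrow B$ infer $\Gamma[\Diamond A]\Rightarrow B$; - $(\Rightarrow\Diamond)$: from $\Gamma\Rightarrow A$ infer $\langle\Gamma\rangle\Rightarrow\Diamond A$; - $(\Box^{\downarrow}\Rightarrow)$: from $\Gamma[A]\Rightarrow B$ infer $\Gamma[\langle\Box^{\downarrow}A\rangle]\Rightarrow B$; - $(\Rightarrow\Box^{\downarrow})$: from $\langle\Gamma\rangle\Rightarrow A$ infer $\Gamma\Rightarrow\Box^{\downarrow}A$;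 - (Cut): from $\Gamma\Rightarrow A$ and $\Delta[A]\Rightarrow B$ infer $\Delta[\Gamma]\Rightarrow B$. An $\mathbf{L}\Diamond$ grammar is a triple $G=(\Sigma,I,D)$, where $\Sigma$ is a finite alphabet, $I$ is a finite set of pairs $(a,A)$ with $a\in\Sigma$ and $A$ a type, and $D$ is a type. It generates a string $a_1\cdots a_n\in\Sigma^*$ ($n\ge 0$) if there is a provable sequent $\Gamma\Rightarrow D$ such that the yield of $\Gamma$ is $A_1\cdots A_n$ and $(a_i,A_i)\in I$ for $i=1,\dots,n$. The language of $G$ is the set of strings that $G$ generates, and a language is recognized by $\mathbf{L}\Diamond$ if it is the language of some $\mathbf{L}\Diamond$ grammar. **Theorem.** Every language recognized by $\mathbf{L}\Diamond$ is context-free. -/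

import Mathlib

namespace LDiamond

/-- Types of the Lambek calculus with brackets, over the primitive types `prim 0, prim 1, …`. -/
inductive Tp : Type where
  /-- a primitive type -/
  | prim (i : ℕ) : Tp
  /-- `under A B` is the type `A \ B` -/
  | under (A B : Tp) : Tp
  /-- `over B A` is the type `B / A` -/
  | over (B A : Tp) : Tp
  /-- the product `A • B` -/
  | prod (A B : Tp) : Tp
  /-- `◇ A` -/
  | dia (A : Tp) : Tp
  /-- `□↓ A` -/
  | box (A : Tp) : Tp

/-- Type trees: a single node labeled by a type, or an unlabeled root
(a pair of angle brackets) over a finite, possibly empty, sequence of type trees. -/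
inductive Tree : Type where
  | leaf (A : Tp) : Tree
  | brackets (Γ : List Tree) : Tree

/-- Type hedges: finite sequences of type trees. Concatenation of hedges is `++`. -/
abbrev Hedge : Type := List Tree

/-- The one-node hedge labeled by a type. -/
abbrev Hedge.single (A : Tp) : Hedge := [Tree.leaf A]

/-- The hedge `⟨Γ⟩`. -/
abbrev Hedge.bracket (Γ : Hedge) : Hedge := [Tree.brackets Γ]

mutual
/-- The string of types labeling the leaves of a type tree, from left to right. -/
def Tree.yield : Tree → List Tp
  | .leaf A => [A]
  | .brackets Γ => Hedge.yield Γ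
/-- The string of types labeling the leaves of a type hedge, from left to right. -/
def Hedge.yield : List Tree → List Tp
  | [] => []
  | T :: Γ => Tree.yield T ++ Hedge.yield Γ
end

/-- Contexts: type hedges with exactly one leaf labeled by a hole.
The hole is either at the top level, between two hedges, or inside one of the
top-level bracketed trees. -/
inductive Context : Type where
  /-- `P ■ Q` -/
  | hole (P Q : Hedge) : Context
  /-- `P ⟨Γ[■]⟩ Q` -/
  | nest (P : Hedge) (Γ : Context) (Q : Hedge) : Context

/-- `Γ.fill Δ` is `Γ[Δ]`, the result of replacing the hole of `Γ` by the hedge `Δ`. -/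
def Context.fill : Context → Hedge → Hedge
  | .hole P Q, Δ => P ++ Δ ++ Q
  | .nest P Γ Q, Δ => P ++ Hedge.bracket (Γ.fill Δ) ++ Q

/-- `Provable Γ C`: the sequent `Γ ⇒ C` is provable in the Lambek calculus with brackets
(with the nonemptiness restriction in the right rules for `\` and `/`). -/
inductive Provable : Hedge → Tp → Prop where
  | init (i : ℕ) : Provable (Hedge.single (.prim i)) (.prim i)
  | underL {Γ : Hedge} {Δ : Context} {A B C : Tp} :
      Provable Γ A → Provable (Δ.fill (Hedge.single B)) C →
      Provable (Δ.fill (Γ ++ Hedge.single (.under A B))) C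
  | underR {P : Hedge} {A B : Tp} : P ≠ [] →
      Provable (Hedge.single A ++ P) B → Provable P (.under A B)
  | overL {Γ : Hedge} {Δ : Context} {A B C : Tp} :
      Provable Γ A → Provable (Δ.fill (Hedge.single B)) C →
      Provable (Δ.fill (Hedge.single (.over B A) ++ Γ)) C
  | overR {P : Hedge} {A B : Tp} : P ≠ [] →
      Provable (P ++ Hedge.single A) B → Provable P (.over B A)
  | prodL {Γ : Context} {A B C : Tp} :
      Provable (Γ.fill (Hedge.single A ++ Hedge.single B)) C →
      Provable (Γ.fill (Hedge.single (.prod A B))) C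
  | prodR {Γ Δ : Hedge} {A B : Tp} :
      Provable Γ A → Provable Δ B → Provable (Γ ++ Δ) (.prod A B)
  | diaL {Γ : Context} {A B : Tp} :
      Provable (Γ.fill (Hedge.bracket (Hedge.single A))) B →
      Provable (Γ.fill (Hedge.single (.dia A))) B
  | diaR {Γ : Hedge} {A : Tp} :
      Provable Γ A → Provable (Hedge.bracket Γ) (.dia A)
  | boxL {Γ : Context} {A B : Tp} :
      Provable (Γ.fill (Hedge.single A)) B →
      Provable (Γ.fill (Hedge.bracket (Hedge.single (.box A)))) B
  | boxR {Γ : Hedge} {A : Tp} :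
      Provable (Hedge.bracket Γ) A → Provable Γ (.box A)
  | cut {Γ : Hedge} {Δ : Context} {A B : Tp} :
      Provable Γ A → Provable (Δ.fill (Hedge.single A)) B → Provable (Δ.fill Γ) B

/-- A grammar over the alphabet `α` based on the Lambek calculus with brackets: a finite
relation between letters and types, and a distinguished type. -/
structure Grammar (α : Type*) where
  lexicon : Finset (α × Tp)
  goal : Tp

/-- The language generated by `G`: the strings `a₁ … aₙ` for which there is a provable sequent
`Γ ⇒ D`, where `D` is the distinguished type and `Γ` is a hedge with yield `A₁ … Aₙ` such that
`(aᵢ, Aᵢ)` is in the lexicon for every `i`. -/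
def Grammar.language {α : Type*} (G : Grammar α) : Language α :=
  {w | ∃ Γ : Hedge, Provable Γ G.goal ∧
    List.Forall₂ (fun a A => (a, A) ∈ G.lexicon) w (Hedge.yield Γ)}

/-- A language is recognized by the Lambek calculus with brackets if some grammar based on
the calculus generates it. -/
def Recognized {α : Type*} (L : Language α) : Prop :=
  ∃ G : Grammar α, G.language = L

end LDiamond

/-!
A hedge is a balanced string of types and brackets, and the calculus is first replaced by a cut-free
calculus `CF` on such strings, in which primitive types and modalities carry labels. Cut is
eliminated semantically (`Provable.toCF`): every type denotes a set of balanced strings, every rule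
including cut is sound for these denotations, and a string in the denotation of `A` derives `A`.

The grammar has as nonterminals the labeled types with at most `m` occurrences of primitive types
and modalities, all with labels from a finite set, where `m` and the labels are given by the
lexicon and the goal type. Its rules are the derivable sequents `A ⇒ C`, `A B ⇒ C` and `⟨A⟩ ⇒ C`
between these types, together with the lexicon. Since cut is admissible, whatever the grammar
generates is witnessed by a provable sequent (`Gen.exists_provable`). For the converse (`Gen.of_CF`)
a derivable sequent of bounded types is cut down to such rules in two stages.

* Brackets. Following a pair of brackets `⟨u⟩` up a cut-free derivation to the rule that creates it
  shows that it can be replaced by a single bounded type `E` (`CF.exists_bracketType`): either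
  `E = ◇A` with `u ⇒ A`, or `u ⇒ □E`. Both `◇A` and `□E` are subtypes of the sequent, so nothing
  grows, and one rule of the form `⟨A⟩ ⇒ C` accounts for the brackets.

* Sequents without brackets. Roorda's interpolation lemma (`CF.exists_interpolant`) replaces a
  segment of the antecedent by a type in which every label is at most as frequent as in the segment
  and as in the rest of the sequent. Relabeling makes the sequent thin, meaning that no label occurs
  more than twice (`CF.exists_thin`), so that every label occurs at most once in an interpolant.
  Interpret types in the free group on the labels, with both modalities acting by multiplication by
  their labels, inversely to each other. Derivable sequents become equations (`CF.wordVal_eq`), and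
  the size of an interpolant is at most the reduced length of the value of the segment. Reduced
  length makes the free group a tree, and the four-point condition for trees yields a pair of
  adjacent types, or the antecedent without its last type, whose value is no longer than the longest
  type of the sequent (`exists_adjacent_norm_le`). Its interpolant is again bounded, and induction
  applies, as in Pentus's theorem for the Lambek calculus.
-/

namespace LDiamond

/-! ### Bracketed strings -/

/-- Symbols of bracketed strings: leaves labeled by elements of `T`, opening brackets labeled by
elements of `K`, and unlabeled closing brackets. Hedges are represented by balanced strings. -/
inductive Sym (T K : Type) : Type where
  | leaf (A : T) : Sym T K
  | op (k : K) : Sym T K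
  | cl : Sym T K

namespace Sym

variable {T T' K K' : Type}

/-- Relabeling of a symbol. -/
def map (f : T → T') (g : K → K') : Sym T K → Sym T' K'
  | leaf A => leaf (f A)
  | op k => op (g k)
  | cl => cl

/-- The contribution of a symbol to the nesting depth. -/
def depth : Sym T K → ℤ
  | leaf _ => 0
  | op _ => 1
  | cl => -1

@[simp] lemma depth_leaf (A : T) : (leaf A : Sym T K).depth = 0 := rfl
@[simp] lemma depth_op (k : K) : (op k : Sym T K).depth = 1 := rfl
@[simp] lemma depth_cl : (cl : Sym T K).depth = -1 := rfl
@[simp] lemma map_leaf (f : T → T') (g : K → K') (A : T) : map f g (leaf A) = leaf (f A) := rfl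
@[simp] lemma map_op (f : T → T') (g : K → K') (k : K) : map f g (op k) = op (g k) := rfl
@[simp] lemma map_cl (f : T → T') (g : K → K') : map f g cl = cl := rfl

@[simp] lemma depth_map (f : T → T') (g : K → K') (s : Sym T K) : (map f g s).depth = s.depth := by
  cases s <;> rfl

end Sym

open LDiamond.Sym

section Balance

variable {T T' K K' : Type} {u v w x y z l r : List (Sym T K)}

/-- The number of opening brackets minus the number of closing brackets. -/
def dep (w : List (Sym T K)) : ℤ := (w.map Sym.depth).sum

@[simp] lemma dep_nil : dep ([] : List (Sym T K)) = 0 := rfl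
@[simp] lemma dep_cons (s : Sym T K) (w : List (Sym T K)) : dep (s :: w) = s.depth + dep w := by
  simp [dep]
@[simp] lemma dep_append (u v : List (Sym T K)) : dep (u ++ v) = dep u + dep v := by
  simp [dep]

@[simp] lemma dep_map (f : T → T') (g : K → K') (w : List (Sym T K)) :
    dep (w.map (Sym.map f g)) = dep w := by
  induction w with
  | nil => rfl
  | cons s w ih => simp [ih]

/-- A string is balanced if its total depth is zero and no prefix has negative depth. Labels of
brackets are ignored. -/
def Bal (w : List (Sym T K)) : Prop := dep w = 0 ∧ ∀ u v, w = u ++ v → 0 ≤ dep u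

lemma Bal.prefix_nonneg (h : Bal (u ++ v)) : 0 ≤ dep u := h.2 u v rfl

lemma Bal.suffix_nonpos (h : Bal (u ++ v)) : dep v ≤ 0 := by
  have h1 := h.1
  have h2 := h.prefix_nonneg
  simp at h1
  omega

lemma bal_nil : Bal ([] : List (Sym T K)) := by
  refine ⟨rfl, fun u v h => ?_⟩
  simp_all

lemma bal_leaf (A : T) : Bal ([leaf A] : List (Sym T K)) := by
  refine ⟨by simp, fun u v h => ?_⟩
  rcases u with _ | ⟨s, u⟩
  · simp
  · simp at h
    obtain ⟨rfl, rfl, rfl⟩ := h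
    simp

lemma bal_insert (h : Bal w) : Bal (l ++ (w ++ r)) ↔ Bal (l ++ r) := by
  constructor
  · intro H
    refine ⟨by have := H.1; have := h.1; simp_all, fun u v e => ?_⟩
    rcases List.append_eq_append_iff.1 e with ⟨c, rfl, rfl⟩ | ⟨c, rfl, rfl⟩
    · have := H.2 (l ++ (w ++ c)) v (by simp)
      have := h.1
      simp_all
    · exact H.2 u (c ++ (w ++ r)) (by simp)
  · intro H
    refine ⟨by have := H.1; have := h.1; simp_all, fun u v e => ?_⟩
    rcases List.append_eq_append_iff.1 e with ⟨c, rfl, e'⟩ | ⟨c, rfl, rfl⟩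
    · rcases List.append_eq_append_iff.1 e' with ⟨d, rfl, rfl⟩ | ⟨d, rfl, rfl⟩
      · have := H.2 (l ++ d) v (by simp)
        have := h.1
        simp_all
      · have h1 := H.prefix_nonneg
        have h2 := h.prefix_nonneg
        simp
        omega
    · exact H.2 u (c ++ r) (by simp)

lemma bal_cons_leaf (A : T) : Bal (l ++ leaf A :: r) ↔ Bal (l ++ r) := by
  simpa using bal_insert (l := l) (r := r) (bal_leaf (K := K) A)

lemma Bal.append (hu : Bal u) (hv : Bal v) : Bal (u ++ v) := by
  simpa using (bal_insert (l := u) (r := []) hv).2 (by simpa using hu)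

lemma bal_brackets (k : K) : Bal ([op k, cl] : List (Sym T K)) := by
  refine ⟨by simp, fun u v h => ?_⟩
  rcases u with _ | ⟨s, _ | ⟨t, u⟩⟩
  · simp
  · simp at h
    simp [← h.1]
  · simp at h
    obtain ⟨rfl, rfl, rfl, rfl⟩ := h
    simp

lemma Bal.wrap (k : K) (h : Bal w) : Bal (op k :: (w ++ [cl])) := by
  simpa using (bal_insert (l := [op k]) (r := [cl]) h).2 (bal_brackets k)

lemma bal_bracketed_leaf (k : K) (A : T) : Bal (l ++ op k :: leaf A :: cl :: r) ↔ Bal (l ++ r) := by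
  simpa using bal_insert (l := l) (r := r) (w := [op k, leaf A, cl])
    (by simpa using (bal_leaf A).wrap k)

/-- Two overlapping balanced strings overlap in a balanced string. -/
lemma Bal.overlap (h₁ : Bal (x ++ y)) (h₂ : Bal (y ++ z)) : Bal x ∧ Bal y ∧ Bal z := by
  have a := h₁.prefix_nonneg
  have b := h₂.prefix_nonneg
  have c := h₁.1
  have d := h₂.1
  simp at c d
  refine ⟨⟨by omega, fun u v e => ?_⟩, ⟨by omega, fun u v e => ?_⟩, ⟨by omega, fun u v e => ?_⟩⟩
  · exact h₁.2 u (v ++ y) (by simp [e])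
  · exact h₂.2 u (v ++ z) (by simp [e])
  · have := h₂.2 (y ++ u) v (by simp [e])
    simp at this
    omega

lemma Bal.of_append_left (h : Bal (x ++ y)) (hx : Bal x) : Bal y :=
  (Bal.overlap (x := []) (by simpa using hx) h).2.2

lemma Bal.of_append_right (h : Bal (x ++ y)) (hy : Bal y) : Bal x :=
  (Bal.overlap (z := []) h (by simpa using hy)).1

lemma not_bal_cl : ¬ Bal (cl :: w) := fun h => by
  have := h.2 [cl] w rfl
  simp at this

lemma not_bal_op {k : K} : ¬ Bal (w ++ [op k]) := fun h => by
  have := h.suffix_nonpos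
  simp at this

lemma not_bal_leaf_cl {A : T} : ¬ Bal (leaf A :: cl :: w) := fun h => by
  have := h.2 [leaf A, cl] w rfl
  simp at this

lemma not_bal_op_leaf {k : K} {A : T} : ¬ Bal (w ++ [op k, leaf A]) := fun h => by
  have := h.suffix_nonpos
  simp at this

/-- A bracketed balanced string has no proper nonempty balanced prefix. -/
lemma Bal.prefix_of_wrap {k : K} (hw : Bal w) (hu : Bal u) (hne : u ≠ [])
    (e : op k :: (w ++ [cl]) = u ++ v) : u = op k :: (w ++ [cl]) ∧ v = [] := by
  rcases u with _ | ⟨s, u⟩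
  · exact absurd rfl hne
  simp only [List.cons_append, List.cons.injEq] at e
  obtain ⟨rfl, e⟩ := e
  rcases List.append_eq_append_iff.1 e with ⟨c, rfl, e⟩ | ⟨c, rfl, rfl⟩
  · rcases c with _ | ⟨s, c⟩
    · have := hu.1
      have := hw.1
      simp_all
    · simp at e
      obtain ⟨rfl, rfl, rfl⟩ := e
      simp
  · have h1 := hu.1
    have h2 := hw.prefix_nonneg
    simp at h1
    omega

/-- A bracketed balanced string has no proper nonempty balanced suffix. -/
lemma Bal.suffix_of_wrap {k : K} (hw : Bal w) (hv : Bal v) (hne : v ≠ [])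
    (e : op k :: (w ++ [cl]) = u ++ v) : v = op k :: (w ++ [cl]) ∧ u = [] := by
  rcases eq_or_ne u [] with rfl | hu
  · simpa using e.symm
  · have := (e ▸ hw.wrap k : Bal (u ++ v)).of_append_right hv
    exact absurd (hw.prefix_of_wrap this hu e).2 hne

/-- The possible positions of a symbol relative to a substring. -/
lemma locate {s : Sym T K} {l₀ r₀ : List (Sym T K)} (e : l₀ ++ s :: r₀ = l ++ (w ++ r)) :
    (∃ m, l = l₀ ++ s :: m ∧ r₀ = m ++ (w ++ r)) ∨
    (∃ m n, l₀ = l ++ m ∧ w = m ++ s :: n ∧ r₀ = n ++ r) ∨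
    (∃ m, l₀ = l ++ (w ++ m) ∧ r = m ++ s :: r₀) := by
  rcases List.append_eq_append_iff.1 e with ⟨c, rfl, e'⟩ | ⟨c, rfl, e'⟩
  · rcases c with _ | ⟨t, c⟩
    · rcases w with _ | ⟨t, w⟩
      · exact .inr (.inr ⟨[], by simp, by simpa using e'.symm⟩)
      · simp at e'
        obtain ⟨rfl, rfl⟩ := e'
        exact .inr (.inl ⟨[], w, by simp⟩)
    · simp at e'
      obtain ⟨rfl, rfl⟩ := e'
      exact .inl ⟨c, by simp⟩
  · rcases List.append_eq_append_iff.1 e' with ⟨d, rfl, e₂⟩ | ⟨d, rfl, e₂⟩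
    · exact .inr (.inr ⟨d, by simp, e₂⟩)
    · rcases d with _ | ⟨t, d⟩
      · exact .inr (.inr ⟨[], by simp, by simpa using e₂.symm⟩)
      · simp at e₂
        obtain ⟨rfl, rfl⟩ := e₂
        exact .inr (.inl ⟨c, d, by simp⟩)

end Balance

/-! ### The cut-free calculus with labels -/

/-- Types whose primitive types and modalities carry labels from `ι`. As for types without labels,
`ldiv A B` stands for `A \ B` and `rdiv B A` stands for `B / A`. -/
inductive LTp (ι : Type) : Type where
  | prim (i : ι) : LTp ι
  | ldiv (A B : LTp ι) : LTp ι
  | rdiv (B A : LTp ι) : LTp ι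
  | prod (A B : LTp ι) : LTp ι
  | dia (i : ι) (A : LTp ι) : LTp ι
  | box (i : ι) (A : LTp ι) : LTp ι

/-- Symbols of strings of labeled types and brackets. -/
abbrev LSym (ι : Type) : Type := Sym (LTp ι) ι

/-- The cut-free calculus on bracketed strings of labeled types. An opening bracket is tied by its
label to the modality that it is introduced by. Derivable strings are nonempty and balanced; in the
rule for `□↓` on the right, this has to be demanded, since `⟨w⟩` may be balanced without `w` being
so. -/
inductive CF {ι : Type} : List (LSym ι) → LTp ι → Prop where
  | init (i : ι) : CF [leaf (.prim i)] (.prim i)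
  | underL {w l r : List (LSym ι)} {A B C : LTp ι} : CF w A → CF (l ++ leaf B :: r) C →
      CF (l ++ (w ++ leaf (.ldiv A B) :: r)) C
  | underR {w : List (LSym ι)} {A B : LTp ι} : w ≠ [] → CF (leaf A :: w) B → CF w (.ldiv A B)
  | overL {w l r : List (LSym ι)} {A B C : LTp ι} : CF w A → CF (l ++ leaf B :: r) C →
      CF (l ++ leaf (.rdiv B A) :: (w ++ r)) C
  | overR {w : List (LSym ι)} {A B : LTp ι} : w ≠ [] → CF (w ++ [leaf A]) B → CF w (.rdiv B A)
  | prodL {l r : List (LSym ι)} {A B C : LTp ι} : CF (l ++ leaf A :: leaf B :: r) C →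
      CF (l ++ leaf (.prod A B) :: r) C
  | prodR {u v : List (LSym ι)} {A B : LTp ι} : CF u A → CF v B → CF (u ++ v) (.prod A B)
  | diaL {l r : List (LSym ι)} {i : ι} {A C : LTp ι} : CF (l ++ op i :: leaf A :: cl :: r) C →
      CF (l ++ leaf (.dia i A) :: r) C
  | diaR {w : List (LSym ι)} {i : ι} {A : LTp ι} : CF w A → CF (op i :: (w ++ [cl])) (.dia i A)
  | boxL {l r : List (LSym ι)} {i : ι} {A C : LTp ι} : CF (l ++ leaf A :: r) C →
      CF (l ++ op i :: leaf (.box i A) :: cl :: r) C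
  | boxR {w : List (LSym ι)} {i : ι} {A : LTp ι} : w ≠ [] → Bal w → CF (op i :: (w ++ [cl])) A →
      CF w (.box i A)

namespace CF

variable {ι κ : Type} {w : List (LSym ι)} {C : LTp ι}

lemma ne_nil (h : CF w C) : w ≠ [] := by
  induction h <;> simp_all

lemma bal (h : CF w C) : Bal w := by
  induction h with
  | init i => exact bal_leaf _
  | @underL w l r A B C _ _ ih₁ ih₂ =>
    rw [bal_cons_leaf] at ih₂
    rw [bal_insert ih₁, bal_cons_leaf]
    exact ih₂
  | @underR w A B _ _ ih => exact ih.of_append_left (x := [leaf A]) (bal_leaf A)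
  | overL _ _ ih₁ ih₂ =>
    rw [bal_cons_leaf] at ih₂ ⊢
    rwa [bal_insert ih₁]
  | overR _ _ ih => exact ih.of_append_right (bal_leaf _)
  | prodL _ ih => simpa [bal_cons_leaf] using ih
  | prodR _ _ ih₁ ih₂ => exact ih₁.append ih₂
  | diaL _ ih => rwa [bal_bracketed_leaf, ← bal_cons_leaf] at ih
  | diaR _ ih => exact ih.wrap _
  | boxL _ ih => rwa [bal_cons_leaf, ← bal_bracketed_leaf] at ih
  | boxR _ h _ _ => exact h

lemma id (A : LTp ι) : CF [leaf A] A := by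
  induction A with
  | prim i => exact init i
  | ldiv A B ihA ihB =>
    exact underR (by simp) (by simpa using underL (l := []) (r := []) ihA (by simpa using ihB))
  | rdiv B A ihB ihA =>
    exact overR (by simp) (by simpa using overL (l := []) (r := []) ihA (by simpa using ihB))
  | prod A B ihA ihB => exact prodL (l := []) (r := []) (by simpa using prodR ihA ihB)
  | dia i A ih => exact diaL (l := []) (r := []) (by simpa using diaR ih)
  | box i A ih =>
    exact boxR (by simp) (bal_leaf _)
      (by simpa using boxL (l := []) (r := []) (by simpa using ih))

end CF

namespace LTp

variable {ι κ : Type}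

/-- Relabeling of a type. -/
def map (f : ι → κ) : LTp ι → LTp κ
  | prim i => prim (f i)
  | ldiv A B => ldiv (map f A) (map f B)
  | rdiv B A => rdiv (map f B) (map f A)
  | prod A B => prod (map f A) (map f B)
  | dia i A => dia (f i) (map f A)
  | box i A => box (f i) (map f A)

/-- The multiset of labels of the primitive types and modalities of a type. -/
def labs : LTp ι → Multiset ι
  | prim i => {i}
  | ldiv A B => labs A + labs B
  | rdiv B A => labs B + labs A
  | prod A B => labs A + labs B
  | dia i A => {i} + labs A
  | box i A => {i} + labs A

lemma map_map {μ : Type} (f : ι → κ) (g : κ → μ) (A : LTp ι) :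
    map g (map f A) = map (g ∘ f) A := by
  induction A <;> simp_all [map]

lemma labs_map (f : ι → κ) (A : LTp ι) : (map f A).labs = A.labs.map f := by
  induction A <;> simp_all [map, labs]

end LTp

/-- Relabeling of a string. -/
abbrev relabel {ι κ : Type} (f : ι → κ) (w : List (LSym ι)) : List (LSym κ) :=
  w.map (Sym.map (LTp.map f) f)

lemma bal_map_iff {T T' K K' : Type} {f : T → T'} {g : K → K'} {w : List (Sym T K)} :
    Bal (w.map (Sym.map f g)) ↔ Bal w := by
  constructor
  · intro h
    refine ⟨by simpa using h.1, fun u v e => ?_⟩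
    simpa using h.2 (u.map (Sym.map f g)) (v.map (Sym.map f g)) (by simp [e])
  · intro h
    refine ⟨by simpa using h.1, fun u v e => ?_⟩
    obtain ⟨a, b, rfl, rfl, rfl⟩ := List.map_eq_append_iff.1 e
    simpa using h.2 a b rfl

lemma CF.map {ι κ : Type} (f : ι → κ) {w : List (LSym ι)} {C : LTp ι} (h : CF w C) :
    CF (relabel f w) (C.map f) := by
  induction h with
  | init i => exact CF.init _
  | underL _ _ ih₁ ih₂ => simpa [LTp.map] using CF.underL ih₁ (by simpa using ih₂)
  | underR h _ ih => exact CF.underR (by simpa using h) (by simpa using ih)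
  | overL _ _ ih₁ ih₂ => simpa [LTp.map] using CF.overL ih₁ (by simpa using ih₂)
  | overR h _ ih => exact CF.overR (by simpa using h) (by simpa using ih)
  | prodL _ ih => simpa [LTp.map] using CF.prodL (by simpa using ih)
  | prodR _ _ ih₁ ih₂ => simpa [LTp.map] using CF.prodR ih₁ ih₂
  | diaL _ ih => simpa [LTp.map] using CF.diaL (by simpa using ih)
  | diaR _ ih => simpa [LTp.map] using CF.diaR ih
  | boxL _ ih => simpa [LTp.map] using CF.boxL (by simpa using ih)
  | boxR h hb _ ih =>
    exact CF.boxR (by simpa using h) (bal_map_iff.2 hb) (by simpa using ih)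

end LDiamond

namespace LDiamond

open LDiamond.Sym

/-! ### Interpolation -/

section Interpolation

variable {ι : Type} [DecidableEq ι]

/-- The number of occurrences of the label `x` in a type. -/
def LTp.cnt (x : ι) (A : LTp ι) : ℕ := A.labs.count x

/-- The number of occurrences of the label `x` in a symbol. -/
def symCnt (x : ι) : LSym ι → ℕ
  | leaf A => A.cnt x
  | op i => if x = i then 1 else 0
  | cl => 0

/-- The number of occurrences of the label `x` in a string. -/
def wordCnt (x : ι) (w : List (LSym ι)) : ℕ := (w.map (symCnt x)).sum

variable (x : ι)

@[simp] lemma cnt_prim (i : ι) : (LTp.prim i).cnt x = if x = i then 1 else 0 := by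
  simp [LTp.cnt, LTp.labs, Multiset.count_singleton]
@[simp] lemma cnt_ldiv (A B : LTp ι) : (A.ldiv B).cnt x = A.cnt x + B.cnt x := by
  simp [LTp.cnt, LTp.labs]
@[simp] lemma cnt_rdiv (A B : LTp ι) : (B.rdiv A).cnt x = B.cnt x + A.cnt x := by
  simp [LTp.cnt, LTp.labs]
@[simp] lemma cnt_prod (A B : LTp ι) : (A.prod B).cnt x = A.cnt x + B.cnt x := by
  simp [LTp.cnt, LTp.labs]
@[simp] lemma cnt_dia (i : ι) (A : LTp ι) :
    (LTp.dia i A).cnt x = (if x = i then 1 else 0) + A.cnt x := by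
  simp only [LTp.cnt, LTp.labs, Multiset.count_add, Multiset.count_singleton]
@[simp] lemma cnt_box (i : ι) (A : LTp ι) :
    (LTp.box i A).cnt x = (if x = i then 1 else 0) + A.cnt x := by
  simp only [LTp.cnt, LTp.labs, Multiset.count_add, Multiset.count_singleton]
@[simp] lemma symCnt_leaf (A : LTp ι) : symCnt x (leaf A) = A.cnt x := rfl
@[simp] lemma symCnt_op (i : ι) : symCnt x (op i) = if x = i then 1 else 0 := rfl
@[simp] lemma symCnt_cl : symCnt x (cl : LSym ι) = 0 := rfl
@[simp] lemma wordCnt_nil : wordCnt x [] = 0 := rfl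
@[simp] lemma wordCnt_cons (s : LSym ι) (w : List (LSym ι)) :
    wordCnt x (s :: w) = symCnt x s + wordCnt x w := by simp [wordCnt]
@[simp] lemma wordCnt_append (u v : List (LSym ι)) :
    wordCnt x (u ++ v) = wordCnt x u + wordCnt x v := by simp [wordCnt]

/-- The type `E` interpolates the segment `w` of the sequent `l w r ⇒ C`: the segment proves `E`,
it may be replaced by `E`, and no label is more frequent in `E` than in `w` or than in the
remainder of the sequent. -/
structure IsInterpolant (l w r : List (LSym ι)) (C E : LTp ι) : Prop where
  proves : CF w E
  replace : CF (l ++ leaf E :: r) C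
  cnt_le : ∀ x, E.cnt x ≤ wordCnt x w
  cnt_le_rest : ∀ x, E.cnt x ≤ wordCnt x l + wordCnt x r + C.cnt x

lemma IsInterpolant.mk' {l w r : List (LSym ι)} {C E : LTp ι} (h₁ : CF w E)
    (h₂ : CF (l ++ leaf E :: r) C)
    (h₃ : ∀ x, E.cnt x ≤ wordCnt x w ∧ E.cnt x ≤ wordCnt x l + wordCnt x r + C.cnt x) :
    IsInterpolant l w r C E := ⟨h₁, h₂, fun x => (h₃ x).1, fun x => (h₃ x).2⟩

lemma IsInterpolant.weaken {l w r l' w' r' : List (LSym ι)} {C C' E : LTp ι}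
    (h : IsInterpolant l w r C E) (h₁ : CF w' E) (h₂ : CF (l' ++ leaf E :: r') C')
    (h₃ : ∀ x, wordCnt x w ≤ wordCnt x w' ∧
      wordCnt x l + wordCnt x r + C.cnt x ≤ wordCnt x l' + wordCnt x r' + C'.cnt x) :
    IsInterpolant l' w' r' C' E :=
  ⟨h₁, h₂, fun x => (h.cnt_le x).trans (h₃ x).1, fun x => (h.cnt_le_rest x).trans (h₃ x).2⟩

lemma append_cases {α : Type*} {a b c d : List α} (e : a ++ b = c ++ d) :
    (∃ f, f ≠ [] ∧ a = c ++ f ∧ d = f ++ b) ∨ (∃ f, c = a ++ f ∧ b = f ++ d) := by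
  rcases List.append_eq_append_iff.1 e with ⟨f, h₁, h₂⟩ | ⟨f, h₁, h₂⟩
  · exact .inr ⟨f, h₁, h₂⟩
  · rcases eq_or_ne f [] with rfl | hf
    · exact .inr ⟨[], by simpa using h₁.symm, by simpa using h₂.symm⟩
    · exact .inl ⟨f, hf, h₁, h₂⟩

/-- Every nonempty balanced segment of the antecedent of a derivable sequent has an interpolant.
In most cases an interpolant for the premise that contains the segment works for the conclusion,
too. If the segment meets both premises of a rule, interpolants of its two parts are combined by a
division or by a product; both parts are balanced since overlaps of balanced strings are. The
modalities `◇` and `□↓` enter an interpolant if the segment consists of a pair of brackets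
introduced by the last rule. -/
theorem CF.exists_interpolant {w₀ : List (LSym ι)} {C : LTp ι} (h : CF w₀ C) :
    ∀ {l w r : List (LSym ι)}, w₀ = l ++ (w ++ r) → Bal w → w ≠ [] →
      ∃ E, IsInterpolant l w r C E := by
  induction h with
  | init i =>
    intro l w r e _ hne
    rcases l with _ | ⟨s, l⟩
    · rcases w with _ | ⟨s, w⟩
      · exact absurd rfl hne
      · simp at e
        obtain ⟨rfl, rfl, rfl⟩ := e
        exact ⟨.prim i, .mk' (.init i) (.init i) (by simp)⟩
    · simp at e
      exact absurd e.2.2.1 hne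
  | @underL u l₀ r₀ A B C hA hC ihA ihC =>
    intro l w r e hb hne
    have hu := hA.bal
    rw [← List.append_assoc] at e
    rcases locate e with ⟨m, rfl, rfl⟩ | ⟨m, n, e₁, rfl, rfl⟩ | ⟨m, e₁, rfl⟩
    · obtain ⟨E, hE⟩ := ihC (l := l₀ ++ leaf B :: m) (w := w) (r := r) (by simp) hb hne
      exact ⟨E, hE.weaken hE.proves (by simpa using CF.underL hA (by simpa using hE.replace))
        fun x => by constructor <;> simp <;> omega⟩
    · rcases append_cases e₁.symm with ⟨c, hc, rfl, rfl⟩ | ⟨c, rfl, rfl⟩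
      · obtain ⟨hbc, hbm, hbn⟩ := Bal.overlap hu hb
        obtain ⟨E₁, h₁⟩ := ihA (l := []) (w := c) (r := m) rfl hbc hc
        obtain ⟨E₂, h₂⟩ := ihC (l := l₀) (w := leaf B :: n) (r := r) (by simp)
          ((bal_cons_leaf (l := []) B).2 ((bal_cons_leaf (l := []) _).1 hbn)) (by simp)
        -- The segment starts inside the argument and contains the type `A \ B`.
        refine ⟨.ldiv E₁ E₂, .mk' (.underR hne ?_) ?_ fun x => ?_⟩
        · simpa using CF.underL (l := []) h₁.replace h₂.proves
        · simpa using CF.underL h₁.proves h₂.replace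
        have a₁ := h₁.cnt_le x
        have a₂ := h₁.cnt_le_rest x
        have a₃ := h₂.cnt_le x
        have a₄ := h₂.cnt_le_rest x
        simp at a₁ a₂ a₃ a₄ ⊢
        omega
      · obtain ⟨E, hE⟩ := ihC (l := l) (w := c ++ leaf B :: n) (r := r) (by simp)
          (by
            rw [List.append_assoc, bal_insert hu, bal_cons_leaf] at hb
            rwa [bal_cons_leaf]) (by simp)
        exact ⟨E, hE.weaken (by simpa using CF.underL hA hE.proves) hE.replace fun x => by
          constructor <;> simp <;> omega⟩
    · rw [← List.append_assoc] at e₁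
      rcases append_cases e₁.symm with ⟨c, hc, e₂, rfl⟩ | ⟨c, rfl, rfl⟩
      · rcases append_cases e₂.symm with ⟨d, hd, rfl, rfl⟩ | ⟨d, rfl, rfl⟩
        · obtain ⟨hbd, hbc, hbm⟩ := Bal.overlap hb hu
          obtain ⟨E₁, h₁⟩ := ihC (l := l) (w := d) (r := leaf B :: r₀) (by simp) hbd hd
          obtain ⟨E₂, h₂⟩ := ihA (l := []) (w := c) (r := m) rfl hbc hc
          -- The segment ends inside the argument and starts before it.
          refine ⟨.prod E₁ E₂, .mk' (.prodR h₁.proves h₂.proves) (.prodL ?_) fun x => ?_⟩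
          · have h₃ := CF.underL (l := l ++ [leaf E₁]) (r := r₀) h₂.replace
              (by simpa using h₁.replace)
            rw [List.append_assoc] at h₃
            simpa using h₃
          have a₁ := h₁.cnt_le x
          have a₂ := h₁.cnt_le_rest x
          have a₃ := h₂.cnt_le x
          have a₄ := h₂.cnt_le_rest x
          simp at a₁ a₂ a₃ a₄ ⊢
          omega
        · obtain ⟨E, hE⟩ := ihA (l := d) (w := w) (r := m) (by simp) hb hne
          exact ⟨E, hE.weaken hE.proves (by simpa using CF.underL hE.replace hC) fun x => by
            constructor <;> simp <;> omega⟩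
      · obtain ⟨E, hE⟩ := ihC (l := l) (w := w) (r := c ++ leaf B :: r₀) (by simp) hb hne
        exact ⟨E, hE.weaken hE.proves
          (by simpa using CF.underL (l := l ++ leaf E :: c) hA (by simpa using hE.replace))
          fun x => by constructor <;> simp <;> omega⟩
  | @underR w' A B _ h ih =>
    intro l w r e hb hne
    subst e
    obtain ⟨E, hE⟩ := ih (l := leaf A :: l) (w := w) (r := r) (by simp) hb hne
    exact ⟨E, hE.weaken hE.proves (CF.underR (by simp) (by simpa using hE.replace))
        fun x => by constructor <;> simp <;> omega⟩
  | @overL u l₀ r₀ A B C hA hC ihA ihC =>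
    intro l w r e hb hne
    have hu := hA.bal
    rcases locate e with ⟨m, rfl, e₁⟩ | ⟨m, n, rfl, rfl, e₁⟩ | ⟨m, rfl, rfl⟩
    · rcases append_cases e₁ with ⟨c, hc, rfl, e₂⟩ | ⟨c, rfl, rfl⟩
      · rcases append_cases e₂ with ⟨d, hd, rfl, rfl⟩ | ⟨d, rfl, rfl⟩
        · obtain ⟨hbm, hbc, hbd⟩ := Bal.overlap hu hb
          obtain ⟨E₁, h₁⟩ := ihA (l := m) (w := c) (r := []) (by simp) hbc hc
          obtain ⟨E₂, h₂⟩ := ihC (l := l₀ ++ [leaf B]) (w := d) (r := r) (by simp) hbd hd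
          -- The segment starts inside the argument and ends after it.
          refine ⟨.prod E₁ E₂, .mk' (.prodR h₁.proves h₂.proves) (.prodL ?_) fun x => ?_⟩
          · simpa using CF.overL (l := l₀) (r := leaf E₂ :: r) h₁.replace
              (by simpa using h₂.replace)
          have a₁ := h₁.cnt_le x
          have a₂ := h₁.cnt_le_rest x
          have a₃ := h₂.cnt_le x
          have a₄ := h₂.cnt_le_rest x
          simp at a₁ a₂ a₃ a₄ ⊢
          omega
        · obtain ⟨E, hE⟩ := ihA (l := m) (w := w) (r := d) (by simp) hb hne
          exact ⟨E, hE.weaken hE.proves (by simpa using CF.overL hE.replace hC) fun x => by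
            constructor <;> simp <;> omega⟩
      · obtain ⟨E, hE⟩ := ihC (l := l₀ ++ leaf B :: c) (w := w) (r := r) (by simp) hb hne
        exact ⟨E, hE.weaken hE.proves (by simpa using CF.overL hA (by simpa using hE.replace))
          fun x => by constructor <;> simp <;> omega⟩
    · rcases append_cases e₁ with ⟨c, hc, rfl, rfl⟩ | ⟨c, rfl, rfl⟩
      · obtain ⟨hbm, hbn, hbc⟩ :=
          Bal.overlap (x := m ++ [leaf (.rdiv B A)]) (y := n) (by simpa using hb) hu
        obtain ⟨E₁, h₁⟩ := ihA (l := n) (w := c) (r := []) (by simp) hbc hc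
        obtain ⟨E₂, h₂⟩ := ihC (l := l) (w := m ++ [leaf B]) (r := r₀) (by simp)
          ((bal_cons_leaf B).2 ((bal_cons_leaf _).1 hbm)) (by simp)
        -- The segment contains the type `B / A` and ends inside the argument.
        refine ⟨.rdiv E₂ E₁, .mk' (.overR hne ?_) ?_ fun x => ?_⟩
        · simpa using CF.overL (l := m) (r := []) h₁.replace h₂.proves
        · simpa using CF.overL h₁.proves h₂.replace
        have a₁ := h₁.cnt_le x
        have a₂ := h₁.cnt_le_rest x
        have a₃ := h₂.cnt_le x
        have a₄ := h₂.cnt_le_rest x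
        simp at a₁ a₂ a₃ a₄ ⊢
        omega
      · obtain ⟨E, hE⟩ := ihC (l := l) (w := m ++ leaf B :: c) (r := r) (by simp)
          (by rwa [bal_cons_leaf, bal_insert hu, ← bal_cons_leaf B] at hb) (by simp)
        exact ⟨E, hE.weaken (by simpa using CF.overL hA hE.proves) hE.replace fun x => by
          constructor <;> simp <;> omega⟩
    · obtain ⟨E, hE⟩ := ihC (l := l) (w := w) (r := m ++ leaf B :: r₀) (by simp) hb hne
      exact ⟨E, hE.weaken hE.proves
        (by simpa using CF.overL (l := l ++ leaf E :: m) hA (by simpa using hE.replace))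
        fun x => by constructor <;> simp <;> omega⟩
  | @overR w' A B _ h ih =>
    intro l w r e hb hne
    subst e
    obtain ⟨E, hE⟩ := ih (l := l) (w := w) (r := r ++ [leaf A]) (by simp) hb hne
    exact ⟨E, hE.weaken hE.proves (CF.overR (by simp) (by simpa using hE.replace))
        fun x => by constructor <;> simp <;> omega⟩
  | @prodL l₀ r₀ A B C h ih =>
    intro l w r e hb hne
    rcases locate e with ⟨m, rfl, rfl⟩ | ⟨m, n, rfl, rfl, rfl⟩ | ⟨m, rfl, rfl⟩
    · obtain ⟨E, hE⟩ := ih (l := l₀ ++ leaf A :: leaf B :: m) (w := w) (r := r) (by simp) hb hne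
      exact ⟨E, hE.weaken hE.proves (by simpa using CF.prodL (by simpa using hE.replace))
        fun x => by constructor <;> simp <;> omega⟩
    · obtain ⟨E, hE⟩ := ih (l := l) (w := m ++ leaf A :: leaf B :: n) (r := r) (by simp)
        (by simpa [bal_cons_leaf] using hb) (by simp)
      exact ⟨E, hE.weaken (.prodL hE.proves) hE.replace
        fun x => by constructor <;> simp <;> omega⟩
    · obtain ⟨E, hE⟩ := ih (l := l) (w := w) (r := m ++ leaf A :: leaf B :: r₀) (by simp) hb hne
      exact ⟨E, hE.weaken hE.proves
        (by simpa using CF.prodL (l := l ++ leaf E :: m) (by simpa using hE.replace))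
        fun x => by constructor <;> simp <;> omega⟩
  | @prodR u v A B hA hB ihA ihB =>
    intro l w r e hb hne
    rcases append_cases e with ⟨c, hc, rfl, e₁⟩ | ⟨c, rfl, rfl⟩
    · rcases append_cases e₁ with ⟨d, hd, rfl, rfl⟩ | ⟨d, rfl, rfl⟩
      · obtain ⟨hbl, hbc, hbd⟩ := Bal.overlap hA.bal hb
        obtain ⟨E₁, h₁⟩ := ihA (l := l) (w := c) (r := []) (by simp) hbc hc
        obtain ⟨E₂, h₂⟩ := ihB (l := []) (w := d) (r := r) (by simp) hbd hd
        refine ⟨.prod E₁ E₂, .mk' (.prodR h₁.proves h₂.proves)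
          (.prodL (by simpa using CF.prodR h₁.replace h₂.replace)) fun x => ?_⟩
        have a₁ := h₁.cnt_le x
        have a₂ := h₁.cnt_le_rest x
        have a₃ := h₂.cnt_le x
        have a₄ := h₂.cnt_le_rest x
        simp at a₁ a₂ a₃ a₄ ⊢
        omega
      · obtain ⟨E, hE⟩ := ihA (l := l) (w := w) (r := d) rfl hb hne
        exact ⟨E, hE.weaken hE.proves (by simpa using CF.prodR hE.replace hB)
        fun x => by constructor <;> simp <;> omega⟩
    · obtain ⟨E, hE⟩ := ihB (l := c) (w := w) (r := r) rfl hb hne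
      exact ⟨E, hE.weaken hE.proves (by simpa using CF.prodR hA hE.replace)
        fun x => by constructor <;> simp <;> omega⟩
  | @diaL l₀ r₀ i A C h ih =>
    intro l w r e hb hne
    rcases locate e with ⟨m, rfl, rfl⟩ | ⟨m, n, rfl, rfl, rfl⟩ | ⟨m, rfl, rfl⟩
    · obtain ⟨E, hE⟩ := ih (l := l₀ ++ op i :: leaf A :: cl :: m) (w := w) (r := r) (by simp) hb
        hne
      exact ⟨E, hE.weaken hE.proves (by simpa using CF.diaL (by simpa using hE.replace))
        fun x => by constructor <;> simp <;> omega⟩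
    · obtain ⟨E, hE⟩ := ih (l := l) (w := m ++ op i :: leaf A :: cl :: n) (r := r) (by simp)
        (by rwa [bal_bracketed_leaf, ← bal_cons_leaf]) (by simp)
      exact ⟨E, hE.weaken (.diaL hE.proves) hE.replace
        fun x => by constructor <;> simp <;> omega⟩
    · obtain ⟨E, hE⟩ := ih (l := l) (w := w) (r := m ++ op i :: leaf A :: cl :: r₀) (by simp) hb
        hne
      exact ⟨E, hE.weaken hE.proves
        (by simpa using CF.diaL (l := l ++ leaf E :: m) (by simpa using hE.replace))
        fun x => by constructor <;> simp <;> omega⟩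
  | @diaR u i A h ih =>
    intro l w r e hb hne
    rcases l with _ | ⟨s, l⟩
    · obtain ⟨rfl, rfl⟩ := h.bal.prefix_of_wrap hb hne e
      obtain ⟨E, hE⟩ := ih (l := []) (w := u) (r := []) (by simp) h.bal h.ne_nil
      refine ⟨.dia i E, .mk' (.diaR hE.proves)
        (CF.diaL (l := []) (r := []) (by simpa using CF.diaR hE.replace)) fun x => ?_⟩
      have h₁ := hE.cnt_le x
      have h₂ := hE.cnt_le_rest x
      simp at h₁ h₂ ⊢
      omega
    · rcases List.eq_nil_or_concat r with rfl | ⟨r, t, rfl⟩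
      · have := (h.bal.suffix_of_wrap (u := s :: l) hb hne (by simpa using e)).2
        simp at this
      · simp [← List.append_assoc] at e
        obtain ⟨rfl, rfl, rfl⟩ := e
        obtain ⟨E, hE⟩ := ih (l := l) (w := w) (r := r) (by simp) hb hne
        exact ⟨E, hE.weaken hE.proves (by simpa using CF.diaR (i := i) hE.replace)
        fun x => by constructor <;> simp <;> omega⟩
  | @boxL l₀ r₀ i A C h ih =>
    intro l w r e hb hne
    rw [List.append_cons] at e
    rcases locate e with ⟨m, rfl, e₁⟩ | ⟨m, n, e₁, rfl, e₂⟩ | ⟨m, e₁, rfl⟩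
    · rcases m with _ | ⟨s, m⟩
      · rcases w with _ | ⟨s, w⟩
        · exact absurd rfl hne
        · simp at e₁
          exact absurd (e₁.1 ▸ hb) not_bal_cl
      · simp at e₁
        obtain ⟨rfl, rfl⟩ := e₁
        obtain ⟨E, hE⟩ := ih (l := l₀ ++ leaf A :: m) (w := w) (r := r) (by simp) hb hne
        exact ⟨E, hE.weaken hE.proves (by simpa using CF.boxL (i := i) (by simpa using hE.replace))
          fun x => by constructor <;> simp <;> omega⟩
    · rcases List.eq_nil_or_concat m with rfl | ⟨m, t, rfl⟩
      · rcases n with _ | ⟨s, n⟩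
        · simp at e₁ e₂
          subst e₁ e₂
          obtain ⟨E, hE⟩ := ih (l := l₀) (w := [leaf A]) (r := r₀) (by simp) (bal_leaf A) (by simp)
          refine ⟨.box i E, .mk' (.boxR (by simp) (bal_leaf _) ?_)
            (by simpa using CF.boxL (i := i) hE.replace) fun x => ?_⟩
          · simpa using CF.boxL (l := []) (r := []) (i := i) hE.proves
          have h₁ := hE.cnt_le x
          have h₂ := hE.cnt_le_rest x
          simp at h₁ h₂ ⊢
          omega
        · simp at e₂
          exact absurd (by simpa [← e₂.1] using hb) (not_bal_leaf_cl (K := ι))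
      · rw [List.concat_eq_append, ← List.append_assoc] at e₁
        obtain ⟨rfl, e₁⟩ := List.append_inj' e₁ (by simp)
        simp at e₁
        subst e₁
        rcases n with _ | ⟨s, n⟩
        · exact absurd (by simpa using hb) (not_bal_op_leaf (T := LTp ι))
        · simp at e₂
          obtain ⟨rfl, rfl⟩ := e₂
          obtain ⟨E, hE⟩ := ih (l := l) (w := m ++ leaf A :: n) (r := r) (by simp)
            (by
              rw [bal_cons_leaf, ← bal_bracketed_leaf i (.box i A)]
              simpa using hb) (by simp)
          exact ⟨E, hE.weaken (by simpa using CF.boxL (i := i) hE.proves) hE.replace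
            fun x => by constructor <;> simp <;> omega⟩
    · rcases List.eq_nil_or_concat m with rfl | ⟨m, t, rfl⟩
      · rcases List.eq_nil_or_concat w with rfl | ⟨w, t, rfl⟩
        · exact absurd rfl hne
        · rw [List.append_nil, List.concat_eq_append, ← List.append_assoc] at e₁
          obtain ⟨rfl, e₁⟩ := List.append_inj' e₁ (by simp)
          simp at e₁
          subst e₁
          exact absurd (by simpa using hb) (not_bal_op (T := LTp ι))
      · rw [List.concat_eq_append, ← List.append_assoc, ← List.append_assoc] at e₁
        obtain ⟨rfl, e₁⟩ := List.append_inj' e₁ (by simp)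
        simp at e₁
        subst e₁
        obtain ⟨E, hE⟩ := ih (l := l) (w := w) (r := m ++ leaf A :: r₀) (by simp) hb hne
        exact ⟨E, hE.weaken hE.proves
          (by simpa using CF.boxL (i := i) (l := l ++ leaf E :: m) (by simpa using hE.replace))
          fun x => by constructor <;> simp <;> omega⟩
  | @boxR u i A hne' hbu h ih =>
    intro l w r e hb hne
    subst e
    obtain ⟨E, hE⟩ := ih (l := op i :: l) (w := w) (r := r ++ [cl]) (by simp) hb hne
    exact ⟨E, hE.weaken hE.proves
      (CF.boxR (by simp) ((bal_cons_leaf _).2 ((bal_insert hb).1 hbu))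
        (by simpa using hE.replace))
      fun x => by constructor <;> simp <;> omega⟩

end Interpolation

end LDiamond

namespace LDiamond

open LDiamond.Sym

/-! ### Types of brackets -/

section BracketTypes

variable {ι : Type}

/-- A set of types closed under subtypes. -/
structure SubClosed (S : LTp ι → Prop) : Prop where
  ldiv {A B : LTp ι} : S (.ldiv A B) → S A ∧ S B
  rdiv {A B : LTp ι} : S (.rdiv B A) → S B ∧ S A
  prod {A B : LTp ι} : S (.prod A B) → S A ∧ S B
  dia {i : ι} {A : LTp ι} : S (.dia i A) → S A
  box {i : ι} {A : LTp ι} : S (.box i A) → S A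

/-- All types occurring in the string `w` belong to `S`. -/
def TypesIn (S : LTp ι → Prop) (w : List (LSym ι)) : Prop := ∀ A, leaf A ∈ w → S A

section

variable (S : LTp ι → Prop) (u v w : List (LSym ι))

@[simp] lemma typesIn_nil : TypesIn S [] := fun A h => by simp at h
@[simp] lemma typesIn_leaf (A : LTp ι) : TypesIn S (leaf A :: w) ↔ S A ∧ TypesIn S w := by
  simp [TypesIn]
@[simp] lemma typesIn_op (i : ι) : TypesIn S (op i :: w) ↔ TypesIn S w := by simp [TypesIn]
@[simp] lemma typesIn_cl : TypesIn S (cl :: w) ↔ TypesIn S w := by simp [TypesIn]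
@[simp] lemma typesIn_append : TypesIn S (u ++ v) ↔ TypesIn S u ∧ TypesIn S v := by
  simp [TypesIn, or_imp, forall_and]

end

/-- `D` is a type that may take the place of the bracketed string `⟨w⟩`: either `D` is `◇ A` with
`w ⇒ A`, or `w ⇒ □↓ D`; the type introducing the modality is required to belong to `S`. -/
def IsBracketType (S : LTp ι → Prop) (k : ι) (w : List (LSym ι)) (D : LTp ι) : Prop :=
  (∃ A, D = .dia k A ∧ S (.dia k A) ∧ CF w A) ∨ (S (.box k D) ∧ CF w (.box k D))

lemma IsBracketType.mono {S : LTp ι → Prop} {k : ι} {w w' : List (LSym ι)} {D : LTp ι}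
    (h : IsBracketType S k w D) (hw : ∀ A, CF w A → CF w' A) : IsBracketType S k w' D := by
  rcases h with ⟨A, rfl, hA, h⟩ | ⟨hA, h⟩
  · exact .inl ⟨A, rfl, hA, hw _ h⟩
  · exact .inr ⟨hA, hw _ h⟩

lemma inside_wrap {k : ι} {D : LTp ι} {w m n : List (LSym ι)}
    (e : op k :: (w ++ [cl]) = m ++ leaf D :: n) :
    ∃ m' n', m = op k :: m' ∧ n = n' ++ [cl] ∧ w = m' ++ leaf D :: n' := by
  rcases m with _ | ⟨s, m⟩
  · simp at e
  · simp only [List.cons_append, List.cons.injEq] at e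
    obtain ⟨rfl, e⟩ := e
    rcases List.eq_nil_or_concat n with rfl | ⟨n, t, rfl⟩
    · have := (List.append_inj' e (by simp)).2
      simp at this
    · rw [List.concat_eq_append, ← List.cons_append, ← List.append_assoc] at e
      obtain ⟨rfl, e⟩ := List.append_inj' e (by simp)
      simp at e
      subst e
      exact ⟨m, n, rfl, by simp, rfl⟩

/-- In a cut-free derivation, a pair of brackets stems either from a modality `◇` of the remainder
of the sequent or from a modality `□↓` of its content, so that it can be replaced by a type built
from subtypes of the sequent. The pair is followed upwards to the rule `◇` on the right or `□↓` on
the left that introduces it; the antecedent of a premise cannot overlap it partially, since a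
bracketed string has no proper balanced prefix or suffix. -/
theorem CF.exists_bracketType {S : LTp ι → Prop} (hS : SubClosed S) {w₀ : List (LSym ι)}
    {C : LTp ι} (h : CF w₀ C) :
    ∀ {k : ι} {l w r : List (LSym ι)}, w₀ = l ++ ((op k :: (w ++ [cl])) ++ r) → Bal w →
      TypesIn S w₀ → S C → ∃ D, IsBracketType S k w D ∧ CF (l ++ leaf D :: r) C := by
  induction h with
  | init i =>
    intro k l w r e
    rcases l with _ | ⟨s, l⟩ <;> simp at e
  | @underL u l₀ r₀ A B C hA hC ihA ihC =>
    intro k l w r e hb hT hSC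
    have hu := hA.bal
    simp at hT
    obtain ⟨hT₁, hT₂, hSD, hT₃⟩ := hT
    obtain ⟨hSA, hSB⟩ := hS.ldiv hSD
    rw [← List.append_assoc] at e
    rcases locate e with ⟨m, rfl, rfl⟩ | ⟨m, n, e₁, e₂, rfl⟩ | ⟨m, e₁, rfl⟩
    · obtain ⟨D, hD, hr⟩ := ihC (k := k) (l := l₀ ++ leaf B :: m) (w := w) (r := r) (by simp) hb
        (by simp_all) hSC
      exact ⟨D, hD, by simpa using CF.underL hA (by simpa using hr)⟩
    · obtain ⟨m, n, rfl, rfl, rfl⟩ := inside_wrap e₂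
      have hw := hb.wrap k
      rcases append_cases e₁ with ⟨c, hc, rfl, e₃⟩ | ⟨c, rfl, rfl⟩
      · rcases c with _ | ⟨s, c⟩
        · exact absurd rfl hc
        · simp at e₃
          obtain ⟨rfl, rfl⟩ := e₃
          obtain ⟨D, hD, hr⟩ := ihC (k := k) (l := l) (w := c ++ leaf B :: n) (r := r) (by simp)
            (by
              rw [List.append_assoc, bal_insert hu, bal_cons_leaf] at hb
              rwa [bal_cons_leaf]) (by simp_all) hSC
          exact ⟨D, hD.mono fun A' h => by simpa using CF.underL hA h, hr⟩
      · have := (hb.prefix_of_wrap (k := k) (u := op k :: m)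
          (Bal.overlap (z := leaf (.ldiv A B) :: (n ++ [cl])) hu (by simpa using hw)).2.1 (by simp)
          (v := leaf (.ldiv A B) :: (n ++ [cl])) (by simp)).2
        simp at this
    · rw [← List.append_assoc] at e₁
      rcases append_cases e₁.symm with ⟨c, hc, e₂, rfl⟩ | ⟨c, rfl, rfl⟩
      · rcases append_cases e₂.symm with ⟨d, hd, rfl, e₃⟩ | ⟨d, rfl, rfl⟩
        · exact absurd (hb.prefix_of_wrap (Bal.overlap (e₃ ▸ hb.wrap k) hu).1 hd e₃).2 hc
        · obtain ⟨D, hD, hr⟩ := ihA (k := k) (l := d) (w := w) (r := m) (by simp) hb (by simp_all)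
            hSA
          exact ⟨D, hD, by simpa using CF.underL hr hC⟩
      · obtain ⟨D, hD, hr⟩ := ihC (k := k) (l := l) (w := w) (r := c ++ leaf B :: r₀) (by simp) hb
          (by simp_all) hSC
        exact ⟨D, hD, by simpa using CF.underL (l := l ++ leaf D :: c) hA (by simpa using hr)⟩
  | @underR w' A B _ h ih =>
    intro k l w r e hb hT hSC
    subst e
    obtain ⟨hSA, hSB⟩ := hS.ldiv hSC
    obtain ⟨D, hD, hr⟩ := ih (k := k) (l := leaf A :: l) (w := w) (r := r) (by simp) hb
      (by simp_all) hSB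
    exact ⟨D, hD, CF.underR (by simp) (by simpa using hr)⟩
  | @overL u l₀ r₀ A B C hA hC ihA ihC =>
    intro k l w r e hb hT hSC
    have hu := hA.bal
    simp at hT
    obtain ⟨hT₁, hSD, hT₂, hT₃⟩ := hT
    obtain ⟨hSB, hSA⟩ := hS.rdiv hSD
    rcases locate e with ⟨m, rfl, e₁⟩ | ⟨m, n, rfl, e₂, e₁⟩ | ⟨m, rfl, rfl⟩
    · rcases append_cases e₁ with ⟨c, hc, rfl, e₂⟩ | ⟨c, rfl, rfl⟩
      · rcases append_cases e₂ with ⟨d, hd, e₃, rfl⟩ | ⟨d, rfl, rfl⟩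
        · exact absurd (hb.prefix_of_wrap (Bal.overlap hu (e₃ ▸ hb.wrap k)).2.1 hc e₃).2 hd
        · obtain ⟨D, hD, hr⟩ := ihA (k := k) (l := m) (w := w) (r := d) (by simp) hb (by simp_all)
            hSA
          exact ⟨D, hD, by simpa using CF.overL hr hC⟩
      · obtain ⟨D, hD, hr⟩ := ihC (k := k) (l := l₀ ++ leaf B :: c) (w := w) (r := r) (by simp) hb
          (by simp_all) hSC
        exact ⟨D, hD, by simpa using CF.overL hA (by simpa using hr)⟩
    · obtain ⟨m, n, rfl, rfl, rfl⟩ := inside_wrap e₂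
      have hw := hb.wrap k
      rcases append_cases e₁.symm with ⟨c, hc, e₃, rfl⟩ | ⟨c, rfl, rfl⟩
      · rcases List.eq_nil_or_concat c with rfl | ⟨c, t, rfl⟩
        · exact absurd rfl hc
        · rw [List.concat_eq_append, ← List.append_assoc] at e₃
          obtain ⟨rfl, e₃⟩ := List.append_inj' e₃ (by simp)
          simp at e₃
          subst e₃
          obtain ⟨D, hD, hr⟩ := ihC (k := k) (l := l) (w := m ++ leaf B :: c) (r := r) (by simp)
            (by rwa [bal_cons_leaf, bal_insert hu, ← bal_cons_leaf B] at hb) (by simp_all) hSC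
          exact ⟨D, hD.mono fun A' h => by simpa using CF.overL hA h, hr⟩
      · have hn : Bal (n ++ [cl]) :=
          (Bal.overlap (x := op k :: (m ++ [leaf (.rdiv B A)])) (by simpa using hw) hu).2.1
        have := (hb.suffix_of_wrap (k := k) (u := op k :: (m ++ [leaf (.rdiv B A)])) hn (by simp)
          (by simp)).2
        simp at this
    · obtain ⟨D, hD, hr⟩ := ihC (k := k) (l := l) (w := w) (r := m ++ leaf B :: r₀) (by simp) hb
        (by simp_all) hSC
      exact ⟨D, hD, by simpa using CF.overL (l := l ++ leaf D :: m) hA (by simpa using hr)⟩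
  | @overR w' A B _ h ih =>
    intro k l w r e hb hT hSC
    subst e
    obtain ⟨hSB, hSA⟩ := hS.rdiv hSC
    obtain ⟨D, hD, hr⟩ := ih (k := k) (l := l) (w := w) (r := r ++ [leaf A]) (by simp) hb
      (by simp_all) hSB
    exact ⟨D, hD, CF.overR (by simp) (by simpa using hr)⟩
  | @prodL l₀ r₀ A B C h ih =>
    intro k l w r e hb hT hSC
    simp at hT
    obtain ⟨hT₁, hSD, hT₂⟩ := hT
    obtain ⟨hSA, hSB⟩ := hS.prod hSD
    rcases locate e with ⟨m, rfl, rfl⟩ | ⟨m, n, rfl, e₁, rfl⟩ | ⟨m, rfl, rfl⟩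
    · obtain ⟨D, hD, hr⟩ := ih (k := k) (l := l₀ ++ leaf A :: leaf B :: m) (w := w) (r := r)
        (by simp) hb (by simp_all) hSC
      exact ⟨D, hD, by simpa using CF.prodL (by simpa using hr)⟩
    · obtain ⟨m, n, rfl, rfl, rfl⟩ := inside_wrap e₁
      obtain ⟨D, hD, hr⟩ := ih (k := k) (l := l) (w := m ++ leaf A :: leaf B :: n) (r := r)
        (by simp) (by simpa [bal_cons_leaf] using hb) (by simp_all) hSC
      exact ⟨D, hD.mono fun A' h => CF.prodL h, hr⟩
    · obtain ⟨D, hD, hr⟩ := ih (k := k) (l := l) (w := w) (r := m ++ leaf A :: leaf B :: r₀)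
        (by simp) hb (by simp_all) hSC
      exact ⟨D, hD, by simpa using CF.prodL (l := l ++ leaf D :: m) (by simpa using hr)⟩
  | @prodR u v A B hA hB ihA ihB =>
    intro k l w r e hb hT hSC
    obtain ⟨hSA, hSB⟩ := hS.prod hSC
    rcases append_cases e with ⟨c, hc, rfl, e₁⟩ | ⟨c, rfl, rfl⟩
    · rcases append_cases e₁ with ⟨d, hd, e₂, rfl⟩ | ⟨d, rfl, rfl⟩
      · exact absurd (hb.prefix_of_wrap (Bal.overlap hA.bal (e₂ ▸ hb.wrap k)).2.1 hc e₂).2 hd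
      · obtain ⟨D, hD, hr⟩ := ihA (k := k) (l := l) (w := w) (r := d) rfl hb (by simp_all) hSA
        exact ⟨D, hD, by simpa using CF.prodR hr hB⟩
    · obtain ⟨D, hD, hr⟩ := ihB (k := k) (l := c) (w := w) (r := r) rfl hb (by simp_all) hSB
      exact ⟨D, hD, by simpa using CF.prodR hA hr⟩
  | @diaL l₀ r₀ i A C h ih =>
    intro k l w r e hb hT hSC
    simp at hT
    obtain ⟨hT₁, hSD, hT₂⟩ := hT
    have hSA := hS.dia hSD
    rcases locate e with ⟨m, rfl, rfl⟩ | ⟨m, n, rfl, e₁, rfl⟩ | ⟨m, rfl, rfl⟩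
    · obtain ⟨D, hD, hr⟩ := ih (k := k) (l := l₀ ++ op i :: leaf A :: cl :: m) (w := w) (r := r)
        (by simp) hb (by simp_all) hSC
      exact ⟨D, hD, by simpa using CF.diaL (by simpa using hr)⟩
    · obtain ⟨m, n, rfl, rfl, rfl⟩ := inside_wrap e₁
      obtain ⟨D, hD, hr⟩ := ih (k := k) (l := l) (w := m ++ op i :: leaf A :: cl :: n) (r := r)
        (by simp) (by rwa [bal_bracketed_leaf, ← bal_cons_leaf]) (by simp_all) hSC
      exact ⟨D, hD.mono fun A' h => CF.diaL h, hr⟩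
    · obtain ⟨D, hD, hr⟩ := ih (k := k) (l := l) (w := w)
        (r := m ++ op i :: leaf A :: cl :: r₀) (by simp) hb (by simp_all) hSC
      exact ⟨D, hD, by simpa using CF.diaL (l := l ++ leaf D :: m) (by simpa using hr)⟩
  | @diaR u i A h ih =>
    intro k l w r e hb hT hSC
    rcases l with _ | ⟨s, l⟩
    · obtain ⟨e₁, rfl⟩ := h.bal.prefix_of_wrap (hb.wrap k) (by simp) e
      simp at e₁
      obtain ⟨rfl, rfl⟩ := e₁
      exact ⟨.dia k A, .inl ⟨A, rfl, hSC, h⟩, CF.id _⟩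
    · rcases List.eq_nil_or_concat r with rfl | ⟨r, t, rfl⟩
      · have := (h.bal.suffix_of_wrap (u := s :: l) (hb.wrap k) (by simp) (by simpa using e)).2
        simp at this
      · simp only [List.cons_append, List.cons.injEq, List.concat_eq_append] at e
        obtain ⟨rfl, e⟩ := e
        have e' : u ++ [cl] = (l ++ (op k :: (w ++ [cl]) ++ r)) ++ [t] := by simpa using e
        obtain ⟨rfl, e'⟩ := List.append_inj' e' (by simp)
        simp at e'
        subst e'
        obtain ⟨D, hD, hr⟩ := ih (k := k) (l := l) (w := w) (r := r) (by simp) hb (by simp_all)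
          (hS.dia hSC)
        exact ⟨D, hD, by simpa using CF.diaR (i := i) hr⟩
  | @boxL l₀ r₀ i A C h ih =>
    intro k l w r e hb hT hSC
    simp at hT
    obtain ⟨hT₁, hSD, hT₂⟩ := hT
    have hSA := hS.box hSD
    rw [List.append_cons] at e
    rcases locate e with ⟨m, rfl, e₁⟩ | ⟨m, n, e₁, e₂, e₃⟩ | ⟨m, e₁, rfl⟩
    · rcases m with _ | ⟨s, m⟩
      · simp at e₁
      · simp at e₁
        obtain ⟨rfl, rfl⟩ := e₁
        obtain ⟨D, hD, hr⟩ := ih (k := k) (l := l₀ ++ leaf A :: m) (w := w) (r := r) (by simp) hb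
          (by simp_all) hSC
        exact ⟨D, hD, by simpa using CF.boxL (i := i) (by simpa using hr)⟩
    · obtain ⟨m, n, rfl, rfl, rfl⟩ := inside_wrap e₂
      rcases List.eq_nil_or_concat m with rfl | ⟨m, t, rfl⟩
      · rcases n with _ | ⟨s, n⟩
        · obtain ⟨rfl, e₁⟩ := List.append_inj' e₁ (by simp)
          simp at e₁ e₃
          subst e₁ e₃
          exact ⟨A, .inr ⟨hSD, CF.id _⟩, h⟩
        · simp at e₃
          exact absurd (by simpa [← e₃.1] using hb) (not_bal_leaf_cl (K := ι))
      · rw [List.concat_eq_append, ← List.cons_append, ← List.append_assoc] at e₁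
        obtain ⟨rfl, e₁⟩ := List.append_inj' e₁ (by simp)
        simp at e₁
        subst e₁
        rcases n with _ | ⟨s, n⟩
        · exact absurd (by simpa using hb) (not_bal_op_leaf (T := LTp ι))
        · simp at e₃
          obtain ⟨rfl, rfl⟩ := e₃
          obtain ⟨D, hD, hr⟩ := ih (k := k) (l := l) (w := m ++ leaf A :: n) (r := r) (by simp)
            (by
              rw [bal_cons_leaf, ← bal_bracketed_leaf i (.box i A)]
              simpa using hb) (by simp_all) hSC
          exact ⟨D, hD.mono fun A' h => by simpa using CF.boxL (i := i) h, hr⟩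
    · rcases List.eq_nil_or_concat m with rfl | ⟨m, t, rfl⟩
      · have e₂ : l₀ ++ [op i] = (l ++ op k :: w) ++ [cl] := by simpa using e₁
        have := (List.append_inj' e₂ (by simp)).2
        simp at this
      · rw [List.concat_eq_append, ← List.append_assoc, ← List.append_assoc] at e₁
        obtain ⟨rfl, e₁⟩ := List.append_inj' e₁ (by simp)
        simp at e₁
        subst e₁
        obtain ⟨D, hD, hr⟩ := ih (k := k) (l := l) (w := w) (r := m ++ leaf A :: r₀) (by simp) hb
          (by simp_all) hSC
        exact ⟨D, hD,
          by simpa using CF.boxL (i := i) (l := l ++ leaf D :: m) (by simpa using hr)⟩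
  | @boxR u i A _ _ h ih =>
    intro k l w r e hb hT hSC
    subst e
    obtain ⟨D, hD, hr⟩ := ih (k := k) (l := op i :: l) (w := w) (r := r ++ [cl]) (by simp) hb
      (by simp_all) (hS.box hSC)
    refine ⟨D, hD, CF.boxR (by simp) ?_ (by simpa using hr)⟩
    rename_i hbu
    exact (bal_cons_leaf _).2 ((bal_insert (hb.wrap k)).1 hbu)

end BracketTypes

end LDiamond

namespace LDiamond

open LDiamond.Sym

/-! ### Cut elimination -/

/-- The embedding of types into labeled types: a primitive type is its own label, and all
modalities have the label `0`. -/
def Tp.emb : Tp → LTp ℕ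
  | .prim i => .prim i
  | .under A B => .ldiv A.emb B.emb
  | .over B A => .rdiv B.emb A.emb
  | .prod A B => .prod A.emb B.emb
  | .dia A => .dia 0 A.emb
  | .box A => .box 0 A.emb

/-- Nonempty balanced strings. -/
def Good (w : List (LSym ℕ)) : Prop := Bal w ∧ w ≠ []

/-- The closure of a set `X` of strings: the nonempty balanced strings that may replace the
elements of `X` in the antecedent of every cut-free derivable sequent. -/
def Cl (X : Set (List (LSym ℕ))) : Set (List (LSym ℕ)) :=
  {w | Good w ∧ ∀ l r C, (∀ u ∈ X, CF (l ++ (u ++ r)) C) → CF (l ++ (w ++ r)) C}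

/-- The interpretation of types as closed sets of strings. -/
def Tp.sem : Tp → Set (List (LSym ℕ))
  | .prim i => {w | CF w (.prim i)}
  | .under A B => {w | Good w ∧ ∀ u ∈ A.sem, u ++ w ∈ B.sem}
  | .over B A => {w | Good w ∧ ∀ u ∈ A.sem, w ++ u ∈ B.sem}
  | .prod A B => Cl {w | ∃ u ∈ A.sem, ∃ v ∈ B.sem, w = u ++ v}
  | .dia A => Cl {w | ∃ u ∈ A.sem, w = op 0 :: (u ++ [cl])}
  | .box A => {w | Good w ∧ op 0 :: (w ++ [cl]) ∈ A.sem}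

lemma good_leaf (A : LTp ℕ) : Good [leaf A] := ⟨bal_leaf A, by simp⟩

lemma subset_Cl {X : Set (List (LSym ℕ))} {w : List (LSym ℕ)} (hw : w ∈ X) (h : Good w) :
    w ∈ Cl X := ⟨h, fun _ _ _ H => H w hw⟩

lemma Tp.good_of_mem_sem {A : Tp} {w : List (LSym ℕ)} (h : w ∈ A.sem) : Good w := by
  cases A with
  | prim i => exact ⟨CF.bal h, CF.ne_nil h⟩
  | _ => exact h.1

/-- The interpretation of a type is closed, in every context. -/
lemma Tp.sem_closed : ∀ (A : Tp) {l r w : List (LSym ℕ)} {X : Set (List (LSym ℕ))},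
    Bal (l ++ r) → w ∈ Cl X → (∀ u ∈ X, l ++ (u ++ r) ∈ A.sem) → l ++ (w ++ r) ∈ A.sem
  | .prim _, _, _, _, _, _, hw, h => hw.2 _ _ _ h
  | .under A B, l, r, w, X, hb, hw, h => by
    refine ⟨⟨(bal_insert hw.1.1).2 hb, by simp [hw.1.2]⟩, fun v hv => ?_⟩
    rw [← List.append_assoc]
    refine Tp.sem_closed B ?_ hw fun u hu => ?_
    · rw [List.append_assoc]
      exact (Tp.good_of_mem_sem hv).1.append hb
    · rw [List.append_assoc]
      exact (h u hu).2 v hv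
  | .over B A, l, r, w, X, hb, hw, h => by
    refine ⟨⟨(bal_insert hw.1.1).2 hb, by simp [hw.1.2]⟩, fun v hv => ?_⟩
    rw [List.append_assoc, List.append_assoc]
    refine Tp.sem_closed B ?_ hw fun u hu => ?_
    · rw [← List.append_assoc]
      exact hb.append (Tp.good_of_mem_sem hv).1
    · simpa using (h u hu).2 v hv
  | .prod A B, l, r, w, X, hb, hw, h => by
    refine ⟨⟨(bal_insert hw.1.1).2 hb, by simp [hw.1.2]⟩, fun l' r' C H => ?_⟩
    simpa using hw.2 (l' ++ l) (r ++ r') C fun u hu => by simpa using (h u hu).2 l' r' C H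
  | .dia A, l, r, w, X, hb, hw, h => by
    refine ⟨⟨(bal_insert hw.1.1).2 hb, by simp [hw.1.2]⟩, fun l' r' C H => ?_⟩
    simpa using hw.2 (l' ++ l) (r ++ r') C fun u hu => by simpa using (h u hu).2 l' r' C H
  | .box A, l, r, w, X, hb, hw, h => by
    refine ⟨⟨(bal_insert hw.1.1).2 hb, by simp [hw.1.2]⟩, ?_⟩
    have := Tp.sem_closed A (l := op 0 :: l) (r := r ++ [cl]) (by simpa using hb.wrap 0) hw
      fun u hu => by simpa using (h u hu).2
    simpa using this

/-- A type belongs to its interpretation, and every element of the interpretation proves it. -/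
lemma Tp.emb_mem_sem_and_derives : ∀ A : Tp,
    [leaf A.emb] ∈ A.sem ∧ ∀ w ∈ A.sem, CF w A.emb
  | .prim i => ⟨CF.init i, fun _ h => h⟩
  | .under A B => by
    obtain ⟨hA, hA'⟩ := Tp.emb_mem_sem_and_derives A
    obtain ⟨hB, hB'⟩ := Tp.emb_mem_sem_and_derives B
    refine ⟨⟨good_leaf _, fun u hu => ?_⟩, fun w hw => ?_⟩
    · simpa using Tp.sem_closed B (l := []) (r := []) (X := {[leaf B.emb]}) bal_nil
        ⟨⟨(Tp.good_of_mem_sem hu).1.append (bal_leaf _), by simp⟩, fun l r C H => by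
          simpa [Tp.emb] using CF.underL (hA' u hu) (by simpa using H)⟩ (by simpa using hB)
    · exact CF.underR hw.1.2 (hB' _ (hw.2 _ hA))
  | .over B A => by
    obtain ⟨hA, hA'⟩ := Tp.emb_mem_sem_and_derives A
    obtain ⟨hB, hB'⟩ := Tp.emb_mem_sem_and_derives B
    refine ⟨⟨good_leaf _, fun u hu => ?_⟩, fun w hw => ?_⟩
    · simpa using Tp.sem_closed B (l := []) (r := []) (X := {[leaf B.emb]}) bal_nil
        ⟨⟨(bal_leaf _).append (Tp.good_of_mem_sem hu).1, by simp⟩, fun l r C H => by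
          simpa [Tp.emb] using CF.overL (hA' u hu) (by simpa using H)⟩ (by simpa using hB)
    · exact CF.overR hw.1.2 (hB' _ (hw.2 _ hA))
  | .prod A B => by
    obtain ⟨hA, hA'⟩ := Tp.emb_mem_sem_and_derives A
    obtain ⟨hB, hB'⟩ := Tp.emb_mem_sem_and_derives B
    refine ⟨⟨good_leaf _, fun l r C H => ?_⟩, fun w hw => ?_⟩
    · exact CF.prodL (by simpa using H _ ⟨_, hA, _, hB, rfl⟩)
    · simpa [Tp.emb] using hw.2 [] [] (.prod A.emb B.emb) (by
        rintro _ ⟨u, hu, v, hv, rfl⟩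
        simpa using CF.prodR (hA' u hu) (hB' v hv))
  | .dia A => by
    obtain ⟨hA, hA'⟩ := Tp.emb_mem_sem_and_derives A
    refine ⟨⟨good_leaf _, fun l r C H => ?_⟩, fun w hw => ?_⟩
    · exact CF.diaL (by simpa using H _ ⟨_, hA, rfl⟩)
    · simpa [Tp.emb] using hw.2 [] [] (.dia 0 A.emb) (by
        rintro _ ⟨u, hu, rfl⟩
        simpa using CF.diaR (hA' u hu))
  | .box A => by
    obtain ⟨hA, hA'⟩ := Tp.emb_mem_sem_and_derives A
    refine ⟨⟨good_leaf _, ?_⟩, fun w hw => CF.boxR hw.1.2 hw.1.1 (hA' _ hw.2)⟩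
    simpa [Tp.emb] using Tp.sem_closed A (l := []) (r := []) (X := {[leaf A.emb]}) bal_nil
      ⟨⟨(bal_leaf (.box 0 A.emb)).wrap 0, by simp⟩, fun l r C H => by
        simpa using CF.boxL (by simpa using H)⟩ (by simpa using hA)

mutual
/-- The strings obtained from a type tree by replacing its leaves by elements of their
interpretations. -/
def Tree.sem : Tree → Set (List (LSym ℕ))
  | .leaf A => A.sem
  | .brackets Γ => {w | ∃ u ∈ Hedge.sem Γ, w = op 0 :: (u ++ [cl])}
/-- The strings obtained from a type hedge by replacing its leaves by elements of their
interpretations. -/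
def Hedge.sem : List Tree → Set (List (LSym ℕ))
  | [] => {[]}
  | T :: Γ => {w | ∃ u ∈ Tree.sem T, ∃ v ∈ Hedge.sem Γ, w = u ++ v}
end

lemma Hedge.mem_sem_append {Γ Δ : Hedge} {w : List (LSym ℕ)} :
    w ∈ Hedge.sem (Γ ++ Δ) ↔ ∃ u ∈ Hedge.sem Γ, ∃ v ∈ Hedge.sem Δ, w = u ++ v := by
  induction Γ generalizing w with
  | nil => simp [Hedge.sem]
  | cons T Γ ih =>
    simp only [List.cons_append, Hedge.sem, Set.mem_ofPred_eq, ih]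
    constructor
    · rintro ⟨a, ha, _, ⟨b, hb, c, hc, rfl⟩, rfl⟩
      exact ⟨a ++ b, ⟨a, ha, b, hb, rfl⟩, c, hc, by simp⟩
    · rintro ⟨_, ⟨a, ha, b, hb, rfl⟩, c, hc, rfl⟩
      exact ⟨a, ha, _, ⟨b, hb, c, hc, rfl⟩, by simp⟩

lemma Hedge.mem_sem_single {A : Tp} {w : List (LSym ℕ)} :
    w ∈ Hedge.sem (Hedge.single A) ↔ w ∈ A.sem := by
  simp [Hedge.sem, Tree.sem]

lemma Hedge.mem_sem_bracket {Γ : Hedge} {w : List (LSym ℕ)} :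
    w ∈ Hedge.sem (Hedge.bracket Γ) ↔ ∃ u ∈ Hedge.sem Γ, w = op 0 :: (u ++ [cl]) := by
  simp [Hedge.sem, Tree.sem]

mutual
lemma Tree.good_of_mem_sem : ∀ (T : Tree) {w : List (LSym ℕ)}, w ∈ T.sem → Good w
  | .leaf A, w, h => Tp.good_of_mem_sem h
  | .brackets Γ, w, h => by
    obtain ⟨u, hu, rfl⟩ := h
    exact ⟨(Hedge.bal_of_mem_sem Γ hu).wrap 0, by simp⟩
lemma Hedge.bal_of_mem_sem : ∀ (Γ : Hedge) {w : List (LSym ℕ)}, w ∈ Hedge.sem Γ → Bal w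
  | [], w, h => by
    obtain rfl : w = [] := h
    exact bal_nil
  | T :: Γ, w, h => by
    obtain ⟨u, hu, v, hv, rfl⟩ := h
    exact (Tree.good_of_mem_sem T hu).1.append (Hedge.bal_of_mem_sem Γ hv)
end

lemma Hedge.good_of_mem_sem {Γ : Hedge} (hΓ : Γ ≠ []) {w : List (LSym ℕ)}
    (h : w ∈ Hedge.sem Γ) : Good w := by
  refine ⟨Hedge.bal_of_mem_sem Γ h, ?_⟩
  rcases Γ with _ | ⟨T, Γ⟩
  · exact absurd rfl hΓ
  · obtain ⟨u, hu, v, hv, rfl⟩ := h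
    simp [(Tree.good_of_mem_sem T hu).2]

lemma Context.mem_sem_fill {Δ : Context} {Γ : Hedge} {w : List (LSym ℕ)}
    (h : w ∈ Hedge.sem (Δ.fill Γ)) :
    ∃ l u r, w = l ++ (u ++ r) ∧ u ∈ Hedge.sem Γ ∧ Bal (l ++ r) ∧
      ∀ Γ' : Hedge, ∀ v ∈ Hedge.sem Γ', l ++ (v ++ r) ∈ Hedge.sem (Δ.fill Γ') := by
  induction Δ generalizing w with
  | hole P Q =>
    simp only [Context.fill, List.append_assoc, Hedge.mem_sem_append] at h ⊢
    obtain ⟨a, ha, _, ⟨b, hb, c, hc, rfl⟩, rfl⟩ := h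
    exact ⟨a, b, c, rfl, hb, (Hedge.bal_of_mem_sem _ ha).append (Hedge.bal_of_mem_sem _ hc),
      fun Γ' v hv => ⟨a, ha, _, ⟨v, hv, c, hc, rfl⟩, rfl⟩⟩
  | nest P Δ Q ih =>
    simp only [Context.fill, List.append_assoc, Hedge.mem_sem_append,
      Hedge.mem_sem_bracket] at h ⊢
    obtain ⟨a, ha, _, ⟨_, ⟨b, hb, rfl⟩, c, hc, rfl⟩, rfl⟩ := h
    obtain ⟨l, u, r, rfl, hu, hlr, H⟩ := ih hb
    refine ⟨a ++ op 0 :: l, u, r ++ cl :: c, by simp, hu, ?_, fun Γ' v hv => ?_⟩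
    · simpa using (Hedge.bal_of_mem_sem _ ha).append
        ((hlr.wrap 0).append (Hedge.bal_of_mem_sem _ hc))
    · exact ⟨a, ha, _, ⟨_, ⟨_, H Γ' v hv, rfl⟩, c, hc, rfl⟩, by simp⟩

mutual
/-- No pair of brackets of the tree is empty. -/
def Tree.Full : Tree → Prop
  | .leaf _ => True
  | .brackets Γ => Γ ≠ [] ∧ Hedge.Full Γ
/-- No pair of brackets of the hedge is empty. -/
def Hedge.Full : List Tree → Prop
  | [] => True
  | T :: Γ => Tree.Full T ∧ Hedge.Full Γ
end

lemma Hedge.full_append {Γ Δ : Hedge} :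
    Hedge.Full (Γ ++ Δ) ↔ Hedge.Full Γ ∧ Hedge.Full Δ := by
  induction Γ with
  | nil => simp [Hedge.Full]
  | cons T Γ ih => simp [Hedge.Full, ih, and_assoc]

lemma Context.fill_ne_nil {Δ : Context} {Γ : Hedge} (h : Γ ≠ []) : Δ.fill Γ ≠ [] := by
  cases Δ <;> simp [Context.fill, h]

lemma Context.full_fill {Δ : Context} {Γ Γ' : Hedge} (h : Hedge.Full (Δ.fill Γ))
    (hΓ' : Γ' ≠ [] ∧ (Hedge.Full Γ → Hedge.Full Γ')) : Hedge.Full (Δ.fill Γ') := by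
  induction Δ with
  | hole P Q =>
    simp only [Context.fill, Hedge.full_append] at h ⊢
    exact ⟨⟨h.1.1, hΓ'.2 h.1.2⟩, h.2⟩
  | nest P Δ Q ih =>
    simp only [Context.fill, Hedge.full_append, Hedge.bracket, Hedge.Full, Tree.Full] at h ⊢
    exact ⟨⟨h.1.1, ⟨Context.fill_ne_nil hΓ'.1, ih h.1.2.1.2⟩, trivial⟩, h.2⟩

/-- The antecedent of a provable sequent is nonempty and has no empty pair of brackets. -/
lemma Provable.ne_nil_and_full {Γ : Hedge} {C : Tp} (h : Provable Γ C) :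
    Γ ≠ [] ∧ Hedge.Full Γ := by
  induction h with
  | init i => simp [Hedge.Full, Tree.Full]
  | underL _ _ ih₁ ih₂ =>
    refine ⟨Context.fill_ne_nil (by simp), Context.full_fill ih₂.2 ⟨by simp, fun _ => ?_⟩⟩
    simp [Hedge.full_append, Hedge.Full, Tree.Full, ih₁.2]
  | underR hP _ ih => exact ⟨hP, (Hedge.full_append.1 ih.2).2⟩
  | overL _ _ ih₁ ih₂ =>
    refine ⟨Context.fill_ne_nil (by simp), Context.full_fill ih₂.2 ⟨by simp, fun _ => ?_⟩⟩
    simp [Hedge.Full, Tree.Full, ih₁.2]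
  | overR hP _ ih => exact ⟨hP, (Hedge.full_append.1 ih.2).1⟩
  | prodL _ ih =>
    exact ⟨Context.fill_ne_nil (by simp),
      Context.full_fill ih.2 ⟨by simp, fun _ => by simp [Hedge.Full, Tree.Full]⟩⟩
  | prodR _ _ ih₁ ih₂ => exact ⟨by simp [ih₁.1], Hedge.full_append.2 ⟨ih₁.2, ih₂.2⟩⟩
  | diaL _ ih =>
    exact ⟨Context.fill_ne_nil (by simp),
      Context.full_fill ih.2 ⟨by simp, fun _ => by simp [Hedge.Full, Tree.Full]⟩⟩
  | diaR _ ih => simp [Hedge.Full, Tree.Full, ih]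
  | boxL _ ih =>
    exact ⟨Context.fill_ne_nil (by simp),
      Context.full_fill ih.2 ⟨by simp, fun _ => by simp [Hedge.Full, Tree.Full]⟩⟩
  | boxR _ ih => simpa [Hedge.Full, Tree.Full] using ih
  | cut _ _ ih₁ ih₂ =>
    exact ⟨Context.fill_ne_nil ih₁.1, Context.full_fill ih₂.2 ⟨ih₁.1, fun _ => ih₁.2⟩⟩

/-- Soundness of the calculus with cut for the interpretation by closed sets of strings. -/
theorem Provable.sem_subset {Γ : Hedge} {C : Tp} (h : Provable Γ C) :
    ∀ w ∈ Hedge.sem Γ, w ∈ C.sem := by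
  induction h with
  | init i => exact fun w hw => Hedge.mem_sem_single.1 hw
  | underL _ _ ih₁ ih₂ =>
    intro w hw
    obtain ⟨l, u, r, rfl, hu, -, H⟩ := Context.mem_sem_fill hw
    obtain ⟨a, ha, b, hb, rfl⟩ := Hedge.mem_sem_append.1 hu
    exact ih₂ _ (H _ _ (Hedge.mem_sem_single.2 ((Hedge.mem_sem_single.1 hb).2 a (ih₁ a ha))))
  | underR hP _ ih =>
    exact fun w hw => ⟨Hedge.good_of_mem_sem hP hw, fun u hu =>
      ih _ (Hedge.mem_sem_append.2 ⟨u, Hedge.mem_sem_single.2 hu, w, hw, rfl⟩)⟩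
  | overL _ _ ih₁ ih₂ =>
    intro w hw
    obtain ⟨l, u, r, rfl, hu, -, H⟩ := Context.mem_sem_fill hw
    obtain ⟨a, ha, b, hb, rfl⟩ := Hedge.mem_sem_append.1 hu
    exact ih₂ _ (H _ _ (Hedge.mem_sem_single.2 ((Hedge.mem_sem_single.1 ha).2 b (ih₁ b hb))))
  | overR hP _ ih =>
    exact fun w hw => ⟨Hedge.good_of_mem_sem hP hw, fun u hu =>
      ih _ (Hedge.mem_sem_append.2 ⟨w, hw, u, Hedge.mem_sem_single.2 hu, rfl⟩)⟩
  | prodL _ ih =>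
    intro w hw
    obtain ⟨l, u, r, rfl, hu, hlr, H⟩ := Context.mem_sem_fill hw
    refine Tp.sem_closed _ hlr (Hedge.mem_sem_single.1 hu) ?_
    rintro _ ⟨a, ha, b, hb, rfl⟩
    exact ih _ (H _ _ (Hedge.mem_sem_append.2
      ⟨a, Hedge.mem_sem_single.2 ha, b, Hedge.mem_sem_single.2 hb, rfl⟩))
  | prodR _ _ ih₁ ih₂ =>
    intro w hw
    obtain ⟨a, ha, b, hb, rfl⟩ := Hedge.mem_sem_append.1 hw
    have h₁ := Tp.good_of_mem_sem (ih₁ a ha)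
    have h₂ := Tp.good_of_mem_sem (ih₂ b hb)
    exact subset_Cl ⟨a, ih₁ a ha, b, ih₂ b hb, rfl⟩ ⟨h₁.1.append h₂.1, by simp [h₁.2]⟩
  | diaL _ ih =>
    intro w hw
    obtain ⟨l, u, r, rfl, hu, hlr, H⟩ := Context.mem_sem_fill hw
    refine Tp.sem_closed _ hlr (Hedge.mem_sem_single.1 hu) ?_
    rintro _ ⟨a, ha, rfl⟩
    exact ih _ (H _ _ (Hedge.mem_sem_bracket.2 ⟨a, Hedge.mem_sem_single.2 ha, rfl⟩))
  | diaR _ ih =>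
    intro w hw
    obtain ⟨a, ha, rfl⟩ := Hedge.mem_sem_bracket.1 hw
    exact subset_Cl ⟨a, ih a ha, rfl⟩ ⟨(Tp.good_of_mem_sem (ih a ha)).1.wrap 0, by simp⟩
  | boxL _ ih =>
    intro w hw
    obtain ⟨l, u, r, rfl, hu, hlr, H⟩ := Context.mem_sem_fill hw
    obtain ⟨a, ha, rfl⟩ := Hedge.mem_sem_bracket.1 hu
    exact ih _ (H _ _ (Hedge.mem_sem_single.2 (Hedge.mem_sem_single.1 ha).2))
  | boxR h ih =>
    intro w hw
    have hf := h.ne_nil_and_full.2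
    exact ⟨Hedge.good_of_mem_sem (by simpa [Hedge.Full, Tree.Full] using hf.1.1) hw,
      ih _ (Hedge.mem_sem_bracket.2 ⟨w, hw, rfl⟩)⟩
  | cut _ _ ih₁ ih₂ =>
    intro w hw
    obtain ⟨l, u, r, rfl, hu, hlr, H⟩ := Context.mem_sem_fill hw
    exact ih₂ _ (H _ _ (Hedge.mem_sem_single.2 (ih₁ u hu)))

mutual
/-- The string of types and brackets represented by a type tree. -/
def Tree.flat : Tree → List (Sym Tp Unit)
  | .leaf A => [leaf A]
  | .brackets Γ => op () :: (Hedge.flat Γ ++ [cl])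
/-- The string of types and brackets represented by a type hedge. -/
def Hedge.flat : List Tree → List (Sym Tp Unit)
  | [] => []
  | T :: Γ => Tree.flat T ++ Hedge.flat Γ
end

/-- The embedding of strings of types and brackets into labeled strings. -/
abbrev embWord (w : List (Sym Tp Unit)) : List (LSym ℕ) := w.map (Sym.map Tp.emb fun _ => 0)

mutual
lemma Tree.flat_mem_sem : ∀ T : Tree, embWord T.flat ∈ T.sem
  | .leaf A => by simpa [Tree.flat, Tree.sem] using (Tp.emb_mem_sem_and_derives A).1
  | .brackets Γ => by
    simpa [Tree.flat, Tree.sem] using Hedge.flat_mem_sem Γ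
lemma Hedge.flat_mem_sem : ∀ Γ : Hedge, embWord (Hedge.flat Γ) ∈ Hedge.sem Γ
  | [] => by simp [Hedge.flat, Hedge.sem]
  | T :: Γ => ⟨_, Tree.flat_mem_sem T, _, Hedge.flat_mem_sem Γ, by simp [Hedge.flat]⟩
end

/-- Cut elimination: every provable sequent has a cut-free derivation on the level of strings. -/
theorem Provable.toCF {Γ : Hedge} {C : Tp} (h : Provable Γ C) :
    CF (embWord (Hedge.flat Γ)) C.emb :=
  (Tp.emb_mem_sem_and_derives C).2 _ (h.sem_subset _ (Hedge.flat_mem_sem Γ))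

end LDiamond

namespace LDiamond

open LDiamond.Sym

/-! ### From strings back to hedges -/

mutual
lemma Tree.flat_bal : ∀ T : Tree, Bal T.flat
  | .leaf A => bal_leaf A
  | .brackets Γ => (Hedge.flat_bal Γ).wrap ()
lemma Hedge.flat_bal : ∀ Γ : Hedge, Bal (Hedge.flat Γ)
  | [] => bal_nil
  | T :: Γ => (Tree.flat_bal T).append (Hedge.flat_bal Γ)
end

lemma Hedge.flat_append (Γ Δ : Hedge) : Hedge.flat (Γ ++ Δ) = Hedge.flat Γ ++ Hedge.flat Δ := by
  induction Γ with
  | nil => rfl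
  | cons T Γ ih => simp [Hedge.flat, ih]

lemma Bal.append_cl_inj {T K : Type} {x y u v : List (Sym T K)} (hx : Bal x) (hy : Bal y)
    (e : x ++ cl :: u = y ++ cl :: v) : x = y ∧ u = v := by
  rcases append_cases e with ⟨f, hf, rfl, e'⟩ | ⟨f, rfl, e'⟩
  · rcases f with _ | ⟨s, f⟩
    · exact absurd rfl hf
    · simp at e'
      obtain ⟨rfl, rfl⟩ := e'
      exact absurd (hx.of_append_left hy) not_bal_cl
  · rcases f with _ | ⟨s, f⟩
    · simpa using e'
    · simp at e'
      obtain ⟨rfl, rfl⟩ := e'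
      exact absurd (hy.of_append_left hx) not_bal_cl

lemma Hedge.flat_injective : ∀ {Γ Δ : Hedge}, Hedge.flat Γ = Hedge.flat Δ → Γ = Δ
  | [], [], _ => rfl
  | [], .leaf A :: Δ, e => by simp [Hedge.flat, Tree.flat] at e
  | [], .brackets G :: Δ, e => by simp [Hedge.flat, Tree.flat] at e
  | .leaf A :: Γ, [], e => by simp [Hedge.flat, Tree.flat] at e
  | .leaf A :: Γ, .leaf B :: Δ, e => by
    simp [Hedge.flat, Tree.flat] at e
    rw [e.1, Hedge.flat_injective e.2]
  | .leaf A :: Γ, .brackets G :: Δ, e => by simp [Hedge.flat, Tree.flat] at e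
  | .brackets G :: Γ, [], e => by simp [Hedge.flat, Tree.flat] at e
  | .brackets G :: Γ, .leaf A :: Δ, e => by simp [Hedge.flat, Tree.flat] at e
  | .brackets G :: Γ, .brackets G' :: Δ, e => by
    simp [Hedge.flat, Tree.flat] at e
    obtain ⟨h₁, h₂⟩ := (Hedge.flat_bal G).append_cl_inj (Hedge.flat_bal G') e
    rw [Hedge.flat_injective h₁, Hedge.flat_injective h₂]

/-- A balanced prefix of the string of a hedge represents an initial segment of the hedge. -/
lemma Hedge.exists_of_flat_eq_append {Γ : Hedge} : ∀ {x y : List (Sym Tp Unit)},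
    Hedge.flat Γ = x ++ y → Bal x →
      ∃ Γ₁ Γ₂, Γ = Γ₁ ++ Γ₂ ∧ Hedge.flat Γ₁ = x ∧ Hedge.flat Γ₂ = y := by
  induction Γ with
  | nil =>
    intro x y e _
    simp [Hedge.flat] at e
    obtain ⟨rfl, rfl⟩ := e
    exact ⟨[], [], rfl, rfl, rfl⟩
  | cons T Γ ih =>
    intro x y e hx
    rcases eq_or_ne x [] with rfl | hne
    · exact ⟨[], T :: Γ, rfl, rfl, e⟩
    have key : ∃ f, x = T.flat ++ f ∧ Hedge.flat Γ = f ++ y := by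
      rcases append_cases e with ⟨f, hf, e₁, e₂⟩ | ⟨f, e₁, e₂⟩
      · cases T with
        | leaf A =>
          rcases x with _ | ⟨s, x⟩
          · exact absurd rfl hne
          · simp [Tree.flat] at e₁
            exact absurd e₁.2.2 hf
        | brackets G => exact absurd ((Hedge.flat_bal G).prefix_of_wrap hx hne e₁).2 hf
      · exact ⟨f, e₁, e₂⟩
    obtain ⟨f, rfl, e₂⟩ := key
    obtain ⟨Γ₁, Γ₂, rfl, rfl, rfl⟩ := ih e₂ (hx.of_append_left (Tree.flat_bal T))
    exact ⟨T :: Γ₁, Γ₂, rfl, rfl, rfl⟩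

/-- The context with one more tree in front. -/
def Context.cons (T : Tree) : Context → Context
  | .hole P Q => .hole (T :: P) Q
  | .nest P Δ Q => .nest (T :: P) Δ Q

lemma Context.fill_cons (T : Tree) (Δ : Context) (X : Hedge) :
    (Δ.cons T).fill X = T :: Δ.fill X := by
  cases Δ <;> rfl

/-- An occurrence of the string of a hedge `Ψ` in the string of a hedge `Γ` comes from an
occurrence of `Ψ` in `Γ`. -/
lemma Hedge.exists_context (Ψ : Hedge) : ∀ (Γ : Hedge) {l r : List (Sym Tp Unit)},
    Hedge.flat Γ = l ++ (Hedge.flat Ψ ++ r) →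
      ∃ Δ : Context, Γ = Δ.fill Ψ ∧
        ∀ X : Hedge, Hedge.flat (Δ.fill X) = l ++ (Hedge.flat X ++ r)
  | [], l, r, e => by
    simp [Hedge.flat] at e
    obtain ⟨rfl, e, rfl⟩ := e
    obtain rfl : Ψ = [] := Hedge.flat_injective e
    exact ⟨.hole [] [], rfl, fun X => by simp [Context.fill]⟩
  | T :: Γ, [], r, e => by
    obtain ⟨Γ₁, Γ₂, h, h₁, rfl⟩ := Hedge.exists_of_flat_eq_append (x := Hedge.flat Ψ) e
      (Hedge.flat_bal Ψ)
    obtain rfl := Hedge.flat_injective h₁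
    exact ⟨.hole [] Γ₂, by simpa [Context.fill] using h,
      fun X => by simp [Context.fill, Hedge.flat_append]⟩
  | .leaf A :: Γ, s :: l, r, e => by
    simp [Hedge.flat, Tree.flat] at e
    obtain ⟨rfl, e⟩ := e
    obtain ⟨Δ, rfl, H⟩ := Hedge.exists_context Ψ Γ e
    exact ⟨Δ.cons (.leaf A), (Context.fill_cons _ _ _).symm, fun X => by
      simp [Context.fill_cons, Hedge.flat, Tree.flat, H X]⟩
  | .brackets G :: Γ, s :: l, r, e => by
    simp [Hedge.flat, Tree.flat] at e
    obtain ⟨rfl, e⟩ := e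
    rcases append_cases e with ⟨f, hf, hG, e'⟩ | ⟨f, rfl, e'⟩
    · rcases append_cases e' with ⟨g, hg, hΨ, e''⟩ | ⟨g, rfl, rfl⟩
      · rcases g with _ | ⟨t, g⟩
        · exact absurd rfl hg
        · simp at e''
          obtain ⟨rfl, -⟩ := e''
          have h₁ := (hG ▸ Hedge.flat_bal G).suffix_nonpos
          have h₂ := (hΨ ▸ Hedge.flat_bal Ψ).2 (f ++ [cl]) g (by simp)
          simp at h₂
          omega
      · obtain ⟨Δ, rfl, H⟩ := Hedge.exists_context Ψ G hG
        exact ⟨.nest [] Δ Γ, rfl, fun X => by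
          simp [Context.fill, Hedge.flat, Tree.flat, H X]⟩
    · rcases f with _ | ⟨t, f⟩
      · rcases hΨ : Hedge.flat Ψ with _ | ⟨t, x⟩
        · obtain rfl : Ψ = [] := Hedge.flat_injective hΨ
          simp [hΨ] at e'
          subst e'
          exact ⟨.nest [] (.hole G []) Γ, by simp [Context.fill], fun X => by
            simp [Context.fill, Hedge.flat, Tree.flat, Hedge.flat_append]⟩
        · rw [hΨ] at e'
          simp at e'
          exact absurd (Hedge.flat_bal Ψ) (by rw [hΨ, ← e'.1]; exact not_bal_cl)
      · simp at e'
        obtain ⟨rfl, e'⟩ := e'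
        obtain ⟨Δ, rfl, H⟩ := Hedge.exists_context Ψ Γ e'
        exact ⟨Δ.cons (.brackets G), (Context.fill_cons _ _ _).symm, fun X => by
          simp [Context.fill_cons, Hedge.flat, Tree.flat, H X]⟩

/-- The type underlying a labeled type. -/
def LTp.forget : LTp ℕ → Tp
  | .prim i => .prim i
  | .ldiv A B => .under A.forget B.forget
  | .rdiv B A => .over B.forget A.forget
  | .prod A B => .prod A.forget B.forget
  | .dia _ A => .dia A.forget
  | .box _ A => .box A.forget

lemma LTp.forget_emb (A : Tp) : A.emb.forget = A := by
  induction A <;> simp_all [Tp.emb, LTp.forget]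

/-- The string of types and brackets underlying a labeled string. -/
abbrev forgetWord (w : List (LSym ℕ)) : List (Sym Tp Unit) :=
  w.map (Sym.map LTp.forget fun _ => ())

/-- Every cut-free derivable string is the string of the antecedent of a provable sequent. -/
theorem CF.exists_provable {w : List (LSym ℕ)} {C : LTp ℕ} (h : CF w C) :
    ∃ Γ : Hedge, Hedge.flat Γ = forgetWord w ∧ Provable Γ C.forget := by
  induction h with
  | init i => exact ⟨_, by simp [Hedge.flat, Tree.flat, LTp.forget], Provable.init i⟩
  | @underL w l r A B C _ _ ih₁ ih₂ =>
    obtain ⟨Γ, e₁, h₁⟩ := ih₁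
    obtain ⟨Δ, e₂, h₂⟩ := ih₂
    obtain ⟨Δ, rfl, H⟩ := Hedge.exists_context (Hedge.single B.forget) Δ
      (l := forgetWord l) (r := forgetWord r) (by simpa [Hedge.flat, Tree.flat] using e₂)
    exact ⟨_, by rw [H]; simp [Hedge.flat_append, e₁, Hedge.flat, Tree.flat, LTp.forget],
      Provable.underL h₁ h₂⟩
  | @underR w A B hw _ ih =>
    obtain ⟨Γ, e, h⟩ := ih
    obtain ⟨Γ₁, Γ₂, rfl, e₁, e₂⟩ := Hedge.exists_of_flat_eq_append (x := [leaf A.forget])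
      (by simpa using e) (bal_leaf _)
    obtain rfl : Γ₁ = Hedge.single A.forget :=
      Hedge.flat_injective (by simpa [Hedge.flat, Tree.flat] using e₁)
    refine ⟨Γ₂, e₂, Provable.underR ?_ h⟩
    rintro rfl
    exact hw (by simpa [Hedge.flat] using e₂)
  | @overL w l r A B C _ _ ih₁ ih₂ =>
    obtain ⟨Γ, e₁, h₁⟩ := ih₁
    obtain ⟨Δ, e₂, h₂⟩ := ih₂
    obtain ⟨Δ, rfl, H⟩ := Hedge.exists_context (Hedge.single B.forget) Δ
      (l := forgetWord l) (r := forgetWord r) (by simpa [Hedge.flat, Tree.flat] using e₂)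
    exact ⟨_, by rw [H]; simp [e₁, Hedge.flat, Tree.flat, LTp.forget],
      Provable.overL h₁ h₂⟩
  | @overR w A B hw hA ih =>
    obtain ⟨Γ, e, h⟩ := ih
    obtain ⟨Γ₁, Γ₂, rfl, e₁, e₂⟩ := Hedge.exists_of_flat_eq_append (x := forgetWord w)
      (y := [leaf A.forget]) (by simpa using e)
      (bal_map_iff.2 (hA.bal.of_append_right (bal_leaf _)))
    obtain rfl : Γ₂ = Hedge.single A.forget :=
      Hedge.flat_injective (by simpa [Hedge.flat, Tree.flat] using e₂)
    refine ⟨Γ₁, e₁, Provable.overR ?_ h⟩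
    rintro rfl
    exact hw (by simpa [Hedge.flat] using e₁)
  | @prodL l r A B C _ ih =>
    obtain ⟨Δ, e, h⟩ := ih
    obtain ⟨Δ, rfl, H⟩ := Hedge.exists_context
      (Hedge.single A.forget ++ Hedge.single B.forget) Δ
      (l := forgetWord l) (r := forgetWord r) (by simpa [Hedge.flat, Tree.flat] using e)
    exact ⟨_, by rw [H]; simp [Hedge.flat, Tree.flat, LTp.forget], Provable.prodL h⟩
  | prodR _ _ ih₁ ih₂ =>
    obtain ⟨Γ, e₁, h₁⟩ := ih₁
    obtain ⟨Δ, e₂, h₂⟩ := ih₂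
    exact ⟨_, by simp [Hedge.flat_append, e₁, e₂], Provable.prodR h₁ h₂⟩
  | @diaL l r i A C _ ih =>
    obtain ⟨Δ, e, h⟩ := ih
    obtain ⟨Δ, rfl, H⟩ := Hedge.exists_context (Hedge.bracket (Hedge.single A.forget)) Δ
      (l := forgetWord l) (r := forgetWord r) (by simpa [Hedge.flat, Tree.flat] using e)
    exact ⟨_, by rw [H]; simp [Hedge.flat, Tree.flat, LTp.forget], Provable.diaL h⟩
  | diaR _ ih =>
    obtain ⟨Γ, e, h⟩ := ih
    exact ⟨_, by simp [Hedge.flat, Tree.flat, e], Provable.diaR h⟩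
  | @boxL l r i A C _ ih =>
    obtain ⟨Δ, e, h⟩ := ih
    obtain ⟨Δ, rfl, H⟩ := Hedge.exists_context (Hedge.single A.forget) Δ
      (l := forgetWord l) (r := forgetWord r) (by simpa [Hedge.flat, Tree.flat] using e)
    exact ⟨_, by rw [H]; simp [Hedge.flat, Tree.flat, LTp.forget], Provable.boxL h⟩
  | @boxR w i A hw hb _ ih =>
    obtain ⟨Γ, e, h⟩ := ih
    have hΓ : ∃ G, Γ = Hedge.bracket G ∧ Hedge.flat G = forgetWord w := by
      rcases Γ with _ | ⟨_ | G, Γ⟩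
      · simp [Hedge.flat] at e
      · simp [Hedge.flat, Tree.flat] at e
      · simp [Hedge.flat, Tree.flat] at e
        obtain ⟨h₁, h₂⟩ := (Hedge.flat_bal G).append_cl_inj (bal_map_iff.2 hb) e
        obtain rfl : Γ = [] := Hedge.flat_injective h₂
        exact ⟨G, rfl, h₁⟩
    obtain ⟨G, rfl, eG⟩ := hΓ
    exact ⟨G, eG, Provable.boxR h⟩

end LDiamond

namespace LDiamond

open LDiamond.Sym

/-! ### Thin sequents -/

section Relabeling

variable {ι κ : Type} {f : ι → κ}

lemma relabel_eq_cons_leaf {w : List (LSym ι)} {B : LTp κ} {r : List (LSym κ)}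
    (e : relabel f w = leaf B :: r) :
    ∃ B' r', w = leaf B' :: r' ∧ B'.map f = B ∧ relabel f r' = r := by
  obtain ⟨s, r', rfl, hs, rfl⟩ := List.map_eq_cons_iff.1 e
  cases s <;> simp at hs
  exact ⟨_, _, rfl, hs, rfl⟩

lemma relabel_eq_cons_op {w : List (LSym ι)} {i : κ} {r : List (LSym κ)}
    (e : relabel f w = op i :: r) :
    ∃ j r', w = op j :: r' ∧ f j = i ∧ relabel f r' = r := by
  obtain ⟨s, r', rfl, hs, rfl⟩ := List.map_eq_cons_iff.1 e
  cases s <;> simp at hs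
  exact ⟨_, _, rfl, hs, rfl⟩

lemma relabel_eq_cons_cl {w : List (LSym ι)} {r : List (LSym κ)}
    (e : relabel f w = cl :: r) : ∃ r', w = cl :: r' ∧ relabel f r' = r := by
  obtain ⟨s, r', rfl, hs, rfl⟩ := List.map_eq_cons_iff.1 e
  cases s <;> simp at hs
  exact ⟨_, rfl, rfl⟩

variable [DecidableEq κ]

lemma cnt_map_eq_zero {y : κ} (hy : ∀ x, f x ≠ y) (A : LTp ι) : (A.map f).cnt y = 0 := by
  simp [LTp.cnt, LTp.labs_map, hy]

lemma wordCnt_relabel_eq_zero {y : κ} (hy : ∀ x, f x ≠ y) (w : List (LSym ι)) :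
    wordCnt y (relabel f w) = 0 := by
  induction w with
  | nil => rfl
  | cons s w ih =>
    have hy' : ∀ x, y ≠ f x := fun x => (hy x).symm
    cases s <;> simp_all [relabel, cnt_map_eq_zero]

variable [DecidableEq ι]

lemma cnt_map (hf : f.Injective) (x : ι) (A : LTp ι) : (A.map f).cnt (f x) = A.cnt x := by
  simp [LTp.cnt, LTp.labs_map, Multiset.count_map_eq_count' f _ hf]

lemma wordCnt_relabel (hf : f.Injective) (x : ι) (w : List (LSym ι)) :
    wordCnt (f x) (relabel f w) = wordCnt x w := by
  induction w with
  | nil => rfl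
  | cons s w ih => cases s <;> simp_all [relabel, cnt_map, hf.eq_iff]

end Relabeling

/-- A sequent is thin if every label occurs at most twice in it. -/
def Thin {ι : Type} [DecidableEq ι] (w : List (LSym ι)) (C : LTp ι) : Prop :=
  ∀ x, wordCnt x w + C.cnt x ≤ 2

/-- The labels of a sequent over `ℕ × ℕ` can be renamed so that their second components belong to
the range of a given injective function. -/
lemma Thin.exists_rename {w : List (LSym (ℕ × ℕ))} {C : LTp (ℕ × ℕ)} (h : CF w C)
    (ht : Thin w C) {f : ℕ → ℕ} (hf : f.Injective) :
    ∃ w' C', CF w' C' ∧ relabel Prod.fst w' = relabel Prod.fst w ∧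
      C'.map Prod.fst = C.map Prod.fst ∧ Thin w' C' ∧
      ∀ x : ℕ × ℕ, (∀ n, f n ≠ x.2) → wordCnt x w' = 0 ∧ C'.cnt x = 0 := by
  have hg : (Prod.map id f : ℕ × ℕ → ℕ × ℕ).Injective := Function.injective_id.prodMap hf
  have hc : Prod.fst ∘ (Prod.map id f : ℕ × ℕ → ℕ × ℕ) = Prod.fst := rfl
  refine ⟨_, _, h.map (Prod.map id f), ?_, by rw [LTp.map_map, hc], fun x => ?_,
    fun x hx => ?_⟩
  · rw [relabel, relabel, List.map_map]
    congr 1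
    funext s
    cases s <;> simp [LTp.map_map, hc]
  · by_cases hx : ∃ y, Prod.map id f y = x
    · obtain ⟨y, rfl⟩ := hx
      rw [wordCnt_relabel hg, cnt_map hg]
      exact ht y
    · push Not at hx
      rw [wordCnt_relabel_eq_zero hx, cnt_map_eq_zero hx]
      omega
  · have hx' : ∀ y, Prod.map id f y ≠ x := by
      rintro y rfl
      exact hx y.2 rfl
    exact ⟨wordCnt_relabel_eq_zero hx' w, cnt_map_eq_zero hx' C⟩

/-- Two thin sequents can be renamed apart. -/
lemma Thin.exists_rename_apart {u v : List (LSym (ℕ × ℕ))} {A C : LTp (ℕ × ℕ)} (hA : CF u A)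
    (htA : Thin u A) (hC : CF v C) (htC : Thin v C) :
    ∃ u' A' v' C', CF u' A' ∧ CF v' C' ∧ relabel Prod.fst u' = relabel Prod.fst u ∧
      A'.map Prod.fst = A.map Prod.fst ∧ relabel Prod.fst v' = relabel Prod.fst v ∧
      C'.map Prod.fst = C.map Prod.fst ∧
      ∀ x : ℕ × ℕ, wordCnt x u' + A'.cnt x + wordCnt x v' + C'.cnt x ≤ 2 := by
  obtain ⟨u', A', h₁, e₁, e₂, t₁, z₁⟩ :=
    Thin.exists_rename hA htA (f := fun n => 2 * n) fun a b h => by simpa using h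
  obtain ⟨v', C', h₂, e₃, e₄, t₂, z₂⟩ :=
    Thin.exists_rename hC htC (f := fun n => 2 * n + 1) fun a b h => by simpa using h
  refine ⟨u', A', v', C', h₁, h₂, e₁, e₂, e₃, e₄, fun x => ?_⟩
  have a₁ := t₁ x
  have a₂ := t₂ x
  rcases Nat.even_or_odd x.2 with hx | hx
  · obtain ⟨b₁, b₂⟩ := z₂ x fun n h => by
      rw [← h] at hx
      exact absurd hx (by simp)
    omega
  · obtain ⟨b₁, b₂⟩ := z₁ x fun n h => by
      rw [← h] at hx
      exact absurd hx (by simp)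
    omega

/-- Every cut-free derivable sequent is obtained from a thin one by identifying labels. -/
theorem CF.exists_thin {w : List (LSym ℕ)} {C : LTp ℕ} (h : CF w C) :
    ∃ (w' : List (LSym (ℕ × ℕ))) (C' : LTp (ℕ × ℕ)), CF w' C' ∧ relabel Prod.fst w' = w ∧
      C'.map Prod.fst = C ∧ Thin w' C' := by
  induction h with
  | init i =>
    refine ⟨_, _, CF.init (i, 0), by simp [LTp.map], by simp [LTp.map], fun x => ?_⟩
    simp
    split_ifs <;> omega
  | @underL w l r A B C _ _ ih₁ ih₂ =>
    obtain ⟨w₁, A₁, h₁, e₁, e₂, t₁⟩ := ih₁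
    obtain ⟨w₂, C₂, h₂, e₃, e₄, t₂⟩ := ih₂
    obtain ⟨u, A', v, C', h₃, h₄, f₁, f₂, f₃, f₄, t⟩ := Thin.exists_rename_apart h₁ t₁ h₂ t₂
    obtain ⟨l', _, rfl, rfl, f₅⟩ := List.map_eq_append_iff.1 (f₃.trans e₃)
    obtain ⟨B', r', rfl, rfl, rfl⟩ := relabel_eq_cons_leaf f₅
    refine ⟨_, _, CF.underL h₃ h₄, by simp [LTp.map, ← e₁, ← e₂, f₁, f₂], f₄.trans e₄,
      fun x => ?_⟩
    have := t x
    simp at this ⊢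
    omega
  | underR hne _ ih =>
    obtain ⟨w', C', h, e₁, rfl, t⟩ := ih
    obtain ⟨A', r', rfl, rfl, rfl⟩ := relabel_eq_cons_leaf e₁
    refine ⟨_, _, CF.underR (by simpa using hne) h, rfl, rfl, fun x => ?_⟩
    have := t x
    simp at this ⊢
    omega
  | @overL w l r A B C _ _ ih₁ ih₂ =>
    obtain ⟨w₁, A₁, h₁, e₁, e₂, t₁⟩ := ih₁
    obtain ⟨w₂, C₂, h₂, e₃, e₄, t₂⟩ := ih₂
    obtain ⟨u, A', v, C', h₃, h₄, f₁, f₂, f₃, f₄, t⟩ := Thin.exists_rename_apart h₁ t₁ h₂ t₂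
    obtain ⟨l', _, rfl, rfl, f₅⟩ := List.map_eq_append_iff.1 (f₃.trans e₃)
    obtain ⟨B', r', rfl, rfl, rfl⟩ := relabel_eq_cons_leaf f₅
    refine ⟨_, _, CF.overL h₃ h₄, by simp [LTp.map, ← e₁, ← e₂, f₁, f₂], f₄.trans e₄,
      fun x => ?_⟩
    have := t x
    simp at this ⊢
    omega
  | overR hne _ ih =>
    obtain ⟨w', C', h, e₁, rfl, t⟩ := ih
    obtain ⟨l', _, rfl, rfl, f₅⟩ := List.map_eq_append_iff.1 e₁
    obtain ⟨A', r', rfl, rfl, f₆⟩ := relabel_eq_cons_leaf f₅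
    obtain rfl : r' = [] := by simpa using f₆
    refine ⟨_, _, CF.overR (by simpa using hne) h, rfl, rfl, fun x => ?_⟩
    have := t x
    simp at this ⊢
    omega
  | prodL _ ih =>
    obtain ⟨w', C', h, e₁, rfl, t⟩ := ih
    obtain ⟨l', _, rfl, rfl, f₅⟩ := List.map_eq_append_iff.1 e₁
    obtain ⟨A', _, rfl, rfl, f₆⟩ := relabel_eq_cons_leaf f₅
    obtain ⟨B', r', rfl, rfl, rfl⟩ := relabel_eq_cons_leaf f₆
    refine ⟨_, _, CF.prodL h, by simp [LTp.map], rfl, fun x => ?_⟩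
    have := t x
    simp at this ⊢
    omega
  | prodR _ _ ih₁ ih₂ =>
    obtain ⟨w₁, A₁, h₁, e₁, e₂, t₁⟩ := ih₁
    obtain ⟨w₂, C₂, h₂, e₃, e₄, t₂⟩ := ih₂
    obtain ⟨u, A', v, C', h₃, h₄, f₁, f₂, f₃, f₄, t⟩ := Thin.exists_rename_apart h₁ t₁ h₂ t₂
    refine ⟨_, _, CF.prodR h₃ h₄, by simp [← e₁, ← e₃, f₁, f₃],
      by simp [LTp.map, ← e₂, ← e₄, f₂, f₄], fun x => ?_⟩
    have := t x
    simp at this ⊢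
    omega
  | diaL _ ih =>
    obtain ⟨w', C', h, e₁, rfl, t⟩ := ih
    obtain ⟨l', _, rfl, rfl, f₅⟩ := List.map_eq_append_iff.1 e₁
    obtain ⟨j, _, rfl, rfl, f₆⟩ := relabel_eq_cons_op f₅
    obtain ⟨A', _, rfl, rfl, f₇⟩ := relabel_eq_cons_leaf f₆
    obtain ⟨r', rfl, rfl⟩ := relabel_eq_cons_cl f₇
    refine ⟨_, _, CF.diaL h, by simp [LTp.map], rfl, fun x => ?_⟩
    have := t x
    simp at this ⊢
    omega
  | @diaR w i A _ ih =>
    obtain ⟨w₁, A₁, h₁, rfl, rfl, t₁⟩ := ih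
    -- The second component `0` is freed for the label of the new modality.
    obtain ⟨u, A', h₂, f₁, f₂, t, z⟩ := Thin.exists_rename h₁ t₁ Nat.succ_injective
    refine ⟨_, _, CF.diaR (i := (i, 0)) h₂, by simp [f₁], by simp [LTp.map, f₂], fun x => ?_⟩
    have a := t x
    have b := z x
    simp
    split_ifs with hx
    · subst hx
      have := b (by simp)
      omega
    · omega
  | @boxL l r i A C _ ih =>
    obtain ⟨w₁, C₁, h₁, e₁, rfl, t₁⟩ := ih
    -- The second component `0` is freed for the label of the new modality.
    obtain ⟨u, C', h₂, f₁, f₂, t, z⟩ := Thin.exists_rename h₁ t₁ Nat.succ_injective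
    obtain ⟨l', _, rfl, rfl, f₅⟩ := List.map_eq_append_iff.1 (f₁.trans e₁)
    obtain ⟨A', r', rfl, rfl, rfl⟩ := relabel_eq_cons_leaf f₅
    refine ⟨_, _, CF.boxL (i := (i, 0)) h₂, by simp [LTp.map], f₂, fun x => ?_⟩
    have a := t x
    have b := z x
    simp at a b ⊢
    split_ifs with hx
    · subst hx
      have := b (by simp)
      omega
    · omega
  | boxR hne hb _ ih =>
    obtain ⟨w', C', h, e₁, rfl, t⟩ := ih
    obtain ⟨j, _, rfl, rfl, f₆⟩ := relabel_eq_cons_op e₁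
    obtain ⟨u, _, rfl, rfl, f₇⟩ := List.map_eq_append_iff.1 f₆
    obtain ⟨r', rfl, f₈⟩ := relabel_eq_cons_cl f₇
    obtain rfl : r' = [] := by simpa using f₈
    refine ⟨_, _, CF.boxR (by simpa using hne) (bal_map_iff.1 hb) h, rfl, rfl, fun x => ?_⟩
    have := t x
    simp at this ⊢
    omega

/-! ### Interpretation in a free group -/

section FreeGroup

variable {ι : Type}

/-- The interpretation of labeled types in the free group over the labels. A modality acts by
multiplication from the left with its label. -/
def LTp.val : LTp ι → FreeGroup ι
  | .prim i => .of i
  | .ldiv A B => A.val⁻¹ * B.val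
  | .rdiv B A => B.val * A.val⁻¹
  | .prod A B => A.val * B.val
  | .dia i A => .of i * A.val
  | .box i A => (FreeGroup.of i)⁻¹ * A.val

/-- The interpretation of symbols in the free group. Closing brackets are interpreted by the unit
element. -/
def symVal : LSym ι → FreeGroup ι
  | leaf A => A.val
  | op i => .of i
  | cl => 1

/-- The interpretation of strings in the free group. -/
def wordVal (w : List (LSym ι)) : FreeGroup ι := (w.map symVal).prod

@[simp] lemma wordVal_nil : wordVal ([] : List (LSym ι)) = 1 := rfl
@[simp] lemma wordVal_leaf (A : LTp ι) (w : List (LSym ι)) :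
    wordVal (leaf A :: w) = A.val * wordVal w := by simp [wordVal, symVal]
@[simp] lemma wordVal_op (i : ι) (w : List (LSym ι)) :
    wordVal (op i :: w) = .of i * wordVal w := by simp [wordVal, symVal]
@[simp] lemma wordVal_cl (w : List (LSym ι)) : wordVal (cl :: w) = wordVal w := by
  simp [wordVal, symVal]
@[simp] lemma wordVal_append (u v : List (LSym ι)) :
    wordVal (u ++ v) = wordVal u * wordVal v := by simp [wordVal]

/-- The two sides of a derivable sequent have the same interpretation. -/
lemma CF.wordVal_eq {w : List (LSym ι)} {C : LTp ι} (h : CF w C) : wordVal w = C.val := by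
  induction h with
  | init i => simp
  | underL _ _ ih₁ ih₂ => simp_all [LTp.val, mul_assoc]
  | underR _ _ ih => simp_all [LTp.val, ← ih]
  | overL _ _ ih₁ ih₂ => simp_all [LTp.val, mul_assoc]
  | overR _ _ ih => simp_all [LTp.val, ← ih]
  | prodL _ ih => simp_all [LTp.val, mul_assoc]
  | prodR _ _ ih₁ ih₂ => simp_all [LTp.val]
  | diaL _ ih => simp_all [LTp.val, mul_assoc]
  | diaR _ ih => simp_all [LTp.val]
  | boxL _ ih => simp_all [LTp.val, mul_assoc]
  | boxR _ _ _ ih => simp_all [LTp.val, ← ih]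

/-- The size of a type is the number of its primitive types and modalities. -/
def LTp.size (A : LTp ι) : ℕ := A.labs.card

variable [DecidableEq ι]

lemma LTp.norm_val_le (A : LTp ι) : A.val.norm ≤ A.size := by
  have h := fun x y : FreeGroup ι => FreeGroup.norm_mul_le x y
  induction A with
  | prim i => simp [val, size, labs]
  | ldiv A B ihA ihB =>
    have := h A.val⁻¹ B.val
    simp [val, size, labs] at *
    omega
  | rdiv B A ihB ihA =>
    have := h B.val A.val⁻¹
    simp [val, size, labs] at *
    omega
  | prod A B ihA ihB =>
    have := h A.val B.val
    simp [val, size, labs] at *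
    omega
  | dia i A ih =>
    have := h (.of i) A.val
    simp [val, size, labs] at *
    omega
  | box i A ih =>
    have := h (.of i)⁻¹ A.val
    simp [val, size, labs] at *
    omega

/-- The parity of the exponent sum of the letter `x`. -/
def parity (x : ι) : FreeGroup ι →* Multiplicative (ZMod 2) :=
  FreeGroup.lift fun y => Multiplicative.ofAdd (if y = x then 1 else 0)

lemma parity_val (x : ι) (A : LTp ι) :
    parity x A.val = Multiplicative.ofAdd (A.cnt x : ZMod 2) := by
  have hneg : ∀ a : Multiplicative (ZMod 2), a⁻¹ = a := by decide
  induction A with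
  | prim i => simp [LTp.val, parity, eq_comm]
  | ldiv A B ihA ihB => simp [LTp.val, ihA, ihB, hneg, ofAdd_add]
  | rdiv B A ihB ihA => simp [LTp.val, ihA, ihB, hneg, ofAdd_add]
  | prod A B ihA ihB => simp [LTp.val, ihA, ihB, ofAdd_add]
  | dia i A ih =>
    rw [cnt_dia, LTp.val, map_mul, ih]
    simp [parity, ofAdd_add, eq_comm]
  | box i A ih =>
    rw [cnt_box, LTp.val, map_mul, map_inv, hneg, ih]
    simp [parity, ofAdd_add, eq_comm]

lemma parity_mk_eq_one {x : ι} (w : List (ι × Bool)) (h : ∀ a ∈ w, a.1 ≠ x) :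
    parity x (FreeGroup.mk w) = 1 := by
  simp only [parity, FreeGroup.lift_mk]
  refine List.prod_eq_one fun a ha => ?_
  obtain ⟨⟨y, b⟩, hy, rfl⟩ := List.mem_map.1 ha
  have := h _ hy
  simp_all

/-- If no label is repeated in a type, its size is the norm of its interpretation: every label
survives reduction, as its exponent sum is odd. -/
lemma LTp.size_le_norm_val {A : LTp ι} (h : ∀ x, A.cnt x ≤ 1) : A.size ≤ A.val.norm := by
  have hnd : A.labs.Nodup := Multiset.nodup_iff_count_le_one.2 h
  have hsub : A.labs.toFinset ⊆ (A.val.toWord.map Prod.fst).toFinset := by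
    intro x hx
    by_contra hx'
    have h₁ : parity x A.val = 1 := by
      rw [← FreeGroup.mk_toWord (x := A.val)]
      refine parity_mk_eq_one _ ?_
      rintro ⟨y, b⟩ ha rfl
      exact hx' (List.mem_toFinset.2 (List.mem_map_of_mem ha))
    have h₂ : A.cnt x = 1 :=
      le_antisymm (h x) (Multiset.one_le_count_iff_mem.2 (Multiset.mem_toFinset.1 hx))
    rw [parity_val, h₂] at h₁
    exact absurd h₁ (by decide)
  calc A.size = A.labs.toFinset.card := (Multiset.toFinset_card_of_nodup hnd).symm
    _ ≤ _ := Finset.card_le_card hsub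
    _ ≤ _ := List.toFinset_card_le _
    _ = A.val.norm := by simp [FreeGroup.norm]

end FreeGroup

end LDiamond

namespace LDiamond

open LDiamond.Sym

/-! ### Lengths in free groups -/

section FourPoint

variable {ι : Type} [DecidableEq ι]

lemma exists_common_prefix {β : Type*} [DecidableEq β] : ∀ x y : List β,
    ∃ p x' y', x = p ++ x' ∧ y = p ++ y' ∧ ∀ a ∈ x'.head?, ∀ b ∈ y'.head?, a ≠ b
  | [], y => ⟨[], [], y, rfl, rfl, by simp⟩
  | x, [] => ⟨[], x, [], rfl, rfl, by simp⟩
  | a :: x, b :: y => by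
    by_cases h : a = b
    · subst h
      obtain ⟨p, x', y', rfl, rfl, H⟩ := exists_common_prefix x y
      exact ⟨a :: p, x', y', rfl, rfl, H⟩
    · exact ⟨[], a :: x, b :: y, rfl, rfl, by simpa using h⟩

lemma inv_mul_eq_mk {x y : FreeGroup ι} {p x' y' : List (ι × Bool)} (hx : x.toWord = p ++ x')
    (hy : y.toWord = p ++ y') : x⁻¹ * y = FreeGroup.mk (FreeGroup.invRev x' ++ y') := by
  rw [← FreeGroup.mk_toWord (x := x), ← FreeGroup.mk_toWord (x := y), hx, hy,
    ← FreeGroup.mul_mk, ← FreeGroup.mul_mk, ← FreeGroup.mul_mk, ← FreeGroup.inv_mk]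
  group

/-- The distance of two group elements is the total length of what remains of their reduced words
after removal of the longest common prefix. -/
lemma exists_prefix_norm_inv_mul (x y : FreeGroup ι) :
    ∃ p x' y', x.toWord = p ++ x' ∧ y.toWord = p ++ y' ∧
      (x⁻¹ * y).norm = x'.length + y'.length := by
  obtain ⟨p, x', y', hx, hy, H⟩ := exists_common_prefix x.toWord y.toWord
  refine ⟨p, x', y', hx, hy, ?_⟩
  have hx' : FreeGroup.IsReduced (FreeGroup.invRev x') := by
    have h := FreeGroup.isReduced_toWord (x := x⁻¹)
    rw [FreeGroup.toWord_inv, hx] at h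
    exact h.infix ⟨[], FreeGroup.invRev p, by simp [FreeGroup.invRev]⟩
  have hy' : FreeGroup.IsReduced y' :=
    (hy ▸ FreeGroup.isReduced_toWord (x := y)).infix ⟨p, [], by simp⟩
  have hr : FreeGroup.IsReduced (FreeGroup.invRev x' ++ y') := by
    refine List.isChain_append.2 ⟨hx', hy', ?_⟩
    rintro ⟨a, s⟩ ha ⟨b, t⟩ hb rfl
    rcases x' with _ | ⟨⟨c, r⟩, x'⟩
    · simp [FreeGroup.invRev] at ha
    · simp [FreeGroup.invRev] at ha
      obtain ⟨rfl, rfl⟩ := ha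
      have := H (c, !s) (by simp) (c, t) hb
      simp at this
      cases s <;> cases t <;> simp_all
  rw [inv_mul_eq_mk hx hy, FreeGroup.norm, FreeGroup.toWord_mk, hr.reduce_eq]
  simp

/-- A form of the four-point condition: if neither `a⁻¹` nor `b` takes `g` further away from the
unit element, then `a * b` is no longer than the longer one of `a` and `b`. -/
lemma norm_mul_le_max {g a b : FreeGroup ι} (ha : (g * a⁻¹).norm ≤ g.norm)
    (hb : (g * b).norm ≤ g.norm) : (a * b).norm ≤ max a.norm b.norm := by
  obtain ⟨p, h₁, x', e₁, e₂, e₃⟩ := exists_prefix_norm_inv_mul g⁻¹ a⁻¹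
  obtain ⟨q, h₂, y', f₁, f₂, f₃⟩ := exists_prefix_norm_inv_mul g⁻¹ b
  rw [inv_inv] at e₃ f₃
  have n₁ : g.norm = p.length + h₁.length := by
    rw [← FreeGroup.norm_inv_eq, FreeGroup.norm, e₁, List.length_append]
  have n₂ : g.norm = q.length + h₂.length := by
    rw [← FreeGroup.norm_inv_eq, FreeGroup.norm, f₁, List.length_append]
  have n₃ : a.norm = p.length + x'.length := by
    rw [← FreeGroup.norm_inv_eq, FreeGroup.norm, e₂, List.length_append]
  have n₄ : b.norm = q.length + y'.length := by
    rw [FreeGroup.norm, f₂, List.length_append]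
  have key : ∀ {s u v : List (ι × Bool)}, a⁻¹.toWord = s ++ u → b.toWord = s ++ v →
      (a * b).norm ≤ u.length + v.length := by
    intro s u v hu hv
    have h := inv_mul_eq_mk hu hv
    rw [inv_inv] at h
    rw [h]
    exact FreeGroup.norm_mk_le.trans (by simp)
  rcases List.append_eq_append_iff.1 (e₁.symm.trans f₁) with ⟨c, rfl, -⟩ | ⟨c, rfl, -⟩
  · have := key (s := p) e₂ (by simpa using f₂)
    simp at this n₂ n₄
    omega
  · have := key (s := q) (by simpa using e₂) f₂
    simp at this n₁ n₃
    omega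

/-- In a nonempty product of elements of a free group, either the last factor can be split off
without the remaining product being longer, or there are two adjacent factors whose product is no
longer than the longer one of them. -/
lemma exists_adjacent_norm_le {β : Type*} (f : β → FreeGroup ι) (u : List β) (hu : u ≠ []) :
    (∃ a z, u = a ++ [z] ∧ (a.map f).prod.norm ≤ (u.map f).prod.norm) ∨
    ∃ a x y b, u = a ++ x :: y :: b ∧ (f x * f y).norm ≤ max (f x).norm (f y).norm := by
  induction u using List.reverseRecOn with
  | nil => exact absurd rfl hu
  | append_singleton v z ih =>
    rcases eq_or_ne v [] with rfl | hv
    · exact .inl ⟨[], z, rfl, by simp⟩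
    by_cases h : (v.map f).prod.norm ≤ ((v ++ [z]).map f).prod.norm
    · exact .inl ⟨v, z, rfl, h⟩
    rcases ih hv with ⟨a, y, rfl, h'⟩ | ⟨a, x, y, b, rfl, h'⟩
    -- The factors `y` and `z` surround a partial product that is longer than both of its neighbors.
    · refine .inr ⟨a, y, z, [], by simp, norm_mul_le_max (g := ((a ++ [y]).map f).prod) ?_ ?_⟩
      · simpa using h'
      · simpa [mul_assoc] using (not_le.1 h).le
    · exact .inr ⟨a, x, y, b ++ [z], by simp, h'⟩

end FourPoint

/-! ### Bounded types and leaves of strings -/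

/-- The types of size at most `m` with labels from `Q`. -/
def Bounded (m : ℕ) (Q : Finset ℕ) (A : LTp ℕ) : Prop := A.size ≤ m ∧ ∀ x ∈ A.labs, x ∈ Q

lemma LTp.size_pos {ι : Type} (A : LTp ι) : 0 < A.size := by
  induction A <;> simp_all [size, labs]

/-- The immediate subtypes of a bounded type satisfy a smaller bound. -/
lemma subtypes_bounded (m : ℕ) (Q : Finset ℕ) :
    (∀ A B, Bounded (m + 1) Q (.ldiv A B) → Bounded m Q A ∧ Bounded m Q B) ∧
    (∀ B A, Bounded (m + 1) Q (.rdiv B A) → Bounded m Q B ∧ Bounded m Q A) ∧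
    (∀ A B, Bounded (m + 1) Q (.prod A B) → Bounded m Q A ∧ Bounded m Q B) ∧
    (∀ i A, Bounded (m + 1) Q (.dia i A) → i ∈ Q ∧ Bounded m Q A) ∧
    (∀ i A, Bounded (m + 1) Q (.box i A) → i ∈ Q ∧ Bounded m Q A) := by
  have two : ∀ A B : LTp ℕ, (A.labs + B.labs).card ≤ m + 1 →
      (∀ x ∈ A.labs + B.labs, x ∈ Q) → Bounded m Q A ∧ Bounded m Q B := by
    intro A B h₁ h₂
    have hA := A.size_pos
    have hB := B.size_pos
    rw [Multiset.card_add] at h₁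
    unfold LTp.size at hA hB
    exact ⟨⟨by unfold LTp.size; omega, fun x hx => h₂ x (Multiset.mem_add.2 (.inl hx))⟩,
      ⟨by unfold LTp.size; omega, fun x hx => h₂ x (Multiset.mem_add.2 (.inr hx))⟩⟩
  have one : ∀ (i : ℕ) (A : LTp ℕ), ({i} + A.labs).card ≤ m + 1 →
      (∀ x ∈ {i} + A.labs, x ∈ Q) → i ∈ Q ∧ Bounded m Q A := by
    intro i A h₁ h₂
    rw [Multiset.card_add, Multiset.card_singleton] at h₁
    exact ⟨h₂ i (Multiset.mem_add.2 (.inl (Multiset.mem_singleton_self i))),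
      ⟨by unfold LTp.size; omega, fun x hx => h₂ x (Multiset.mem_add.2 (.inr hx))⟩⟩
  exact ⟨fun A B h => two A B h.1 h.2, fun B A h => two B A h.1 h.2, fun A B h => two A B h.1 h.2,
    fun i A h => one i A h.1 h.2, fun i A h => one i A h.1 h.2⟩

lemma Bounded.mono_succ {m : ℕ} {Q : Finset ℕ} {A : LTp ℕ} (h : Bounded m Q A) :
    Bounded (m + 1) Q A := ⟨h.1.trans m.le_succ, h.2⟩

lemma not_bounded_zero {Q : Finset ℕ} {A : LTp ℕ} : ¬ Bounded 0 Q A :=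
  fun h => absurd h.1 (not_le.2 A.size_pos)

lemma subClosed_bounded (m : ℕ) (Q : Finset ℕ) : SubClosed (Bounded m Q) := by
  rcases m with _ | m
  · constructor <;> exact fun h => absurd h not_bounded_zero
  obtain ⟨h₁, h₂, h₃, h₄, h₅⟩ := subtypes_bounded m Q
  exact ⟨fun h => (h₁ _ _ h).imp Bounded.mono_succ Bounded.mono_succ,
    fun h => (h₂ _ _ h).imp Bounded.mono_succ Bounded.mono_succ,
    fun h => (h₃ _ _ h).imp Bounded.mono_succ Bounded.mono_succ,
    fun h => (h₄ _ _ h).2.mono_succ, fun h => (h₅ _ _ h).2.mono_succ⟩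

lemma finite_bounded (m : ℕ) (Q : Finset ℕ) : {A | Bounded m Q A}.Finite := by
  induction m with
  | zero => exact Set.finite_empty.subset fun A hA => absurd hA not_bounded_zero
  | succ m ih =>
    refine Set.Finite.subset ((Q.finite_toSet.image LTp.prim).union
      ((Set.Finite.image2 LTp.ldiv ih ih).union ((Set.Finite.image2 LTp.rdiv ih ih).union
      ((Set.Finite.image2 LTp.prod ih ih).union ((Set.Finite.image2 LTp.dia Q.finite_toSet ih).union
      (Set.Finite.image2 LTp.box Q.finite_toSet ih)))))) fun A hA => ?_
    obtain ⟨h₁, h₂, h₃, h₄, h₅⟩ := subtypes_bounded m Q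
    cases A with
    | prim i => exact .inl ⟨i, hA.2 i (by simp [LTp.labs]), rfl⟩
    | ldiv A B => exact .inr (.inl ⟨A, (h₁ _ _ hA).1, B, (h₁ _ _ hA).2, rfl⟩)
    | rdiv B A => exact .inr (.inr (.inl ⟨B, (h₂ _ _ hA).1, A, (h₂ _ _ hA).2, rfl⟩))
    | prod A B => exact .inr (.inr (.inr (.inl ⟨A, (h₃ _ _ hA).1, B, (h₃ _ _ hA).2, rfl⟩)))
    | dia i A =>
      exact .inr (.inr (.inr (.inr (.inl ⟨i, (h₄ _ _ hA).1, A, (h₄ _ _ hA).2, rfl⟩))))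
    | box i A =>
      exact .inr (.inr (.inr (.inr (.inr ⟨i, (h₅ _ _ hA).1, A, (h₅ _ _ hA).2, rfl⟩))))

/-- The leaves of a string, from left to right. -/
def leaves {T K : Type} : List (Sym T K) → List T
  | [] => []
  | leaf A :: w => A :: leaves w
  | op _ :: w => leaves w
  | cl :: w => leaves w

section Leaves

variable {T T' K K' : Type}

@[simp] lemma leaves_nil : leaves ([] : List (Sym T K)) = [] := rfl
@[simp] lemma leaves_leaf (A : T) (w : List (Sym T K)) : leaves (leaf A :: w) = A :: leaves w := rfl
@[simp] lemma leaves_op (k : K) (w : List (Sym T K)) : leaves (op k :: w) = leaves w := rfl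
@[simp] lemma leaves_cl (w : List (Sym T K)) : leaves (cl :: w) = leaves w := rfl

@[simp] lemma leaves_append (u v : List (Sym T K)) : leaves (u ++ v) = leaves u ++ leaves v := by
  induction u with
  | nil => rfl
  | cons s u ih => cases s <;> simp [ih]

@[simp] lemma leaves_map (f : T → T') (g : K → K') (w : List (Sym T K)) :
    leaves (w.map (Sym.map f g)) = (leaves w).map f := by
  induction w with
  | nil => rfl
  | cons s w ih => cases s <;> simp [ih]

@[simp] lemma leaves_map_leaf (As : List T) : leaves (As.map (leaf (K := K))) = As := by
  induction As with
  | nil => rfl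
  | cons A As ih => simp [ih]

lemma exists_of_leaves_eq_append_cons {w : List (Sym T K)} : ∀ {X Y : List T} {A : T},
    leaves w = X ++ A :: Y → ∃ l r, w = l ++ leaf A :: r ∧ leaves l = X ∧ leaves r = Y := by
  induction w with
  | nil => intro X Y A e; simp at e
  | cons s w ih =>
    intro X Y A e
    cases s with
    | leaf B =>
      rcases X with _ | ⟨C, X⟩
      · simp at e
        exact ⟨[], w, by simp [e.1], rfl, e.2⟩
      · simp at e
        obtain ⟨rfl, e⟩ := e
        obtain ⟨l, r, rfl, rfl, rfl⟩ := ih e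
        exact ⟨leaf B :: l, r, rfl, rfl, rfl⟩
    | op k =>
      obtain ⟨l, r, rfl, rfl, rfl⟩ := ih e
      exact ⟨op k :: l, r, rfl, rfl, rfl⟩
    | cl =>
      obtain ⟨l, r, rfl, rfl, rfl⟩ := ih e
      exact ⟨cl :: l, r, rfl, rfl, rfl⟩

lemma bal_map_leaf (As : List T) : Bal (As.map (leaf (K := K))) := by
  induction As with
  | nil => exact bal_nil
  | cons A As ih => exact (bal_leaf A).append ih

/-- A balanced string is a string of leaves or contains an innermost pair of brackets. -/
lemma Bal.leaves_or_brackets {w : List (Sym T K)} (h : Bal w) :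
    (∃ As : List T, w = As.map leaf) ∨
      ∃ l k u r, w = l ++ ((op k :: (u ++ [cl])) ++ r) ∧ Bal u := by
  have noOp : ∀ v : List (Sym T K), (∃ As : List T, v = As.map leaf) ∨
      (∃ As : List T, ∃ r, v = As.map leaf ++ cl :: r) ∨
      ∃ As : List T, ∃ k r, v = As.map leaf ++ op k :: r := by
    intro v
    induction v with
    | nil => exact .inl ⟨[], rfl⟩
    | cons s v ih =>
      cases s with
      | leaf A =>
        rcases ih with ⟨As, rfl⟩ | ⟨As, r, rfl⟩ | ⟨As, k, r, rfl⟩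
        · exact .inl ⟨A :: As, rfl⟩
        · exact .inr (.inl ⟨A :: As, r, rfl⟩)
        · exact .inr (.inr ⟨A :: As, k, r, rfl⟩)
      | op k => exact .inr (.inr ⟨[], k, v, rfl⟩)
      | cl => exact .inr (.inl ⟨[], v, rfl⟩)
  -- `n` bounds the length of the part that follows the opening bracket found last.
  have afterOp : ∀ (n : ℕ) (l : List (Sym T K)) (k : K) (v : List (Sym T K)), v.length ≤ n →
      w = l ++ op k :: v → ∃ l k u r, w = l ++ ((op k :: (u ++ [cl])) ++ r) ∧ Bal u := by
    intro n
    induction n with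
    | zero =>
      intro l k v hv e
      obtain rfl : v = [] := by simpa using hv
      exact absurd (e ▸ h) not_bal_op
    | succ n ih =>
      intro l k v hv e
      rcases noOp v with ⟨As, rfl⟩ | ⟨As, r, rfl⟩ | ⟨As, j, r, rfl⟩
      · have h₁ := (e ▸ h).suffix_nonpos
        have h₂ := (bal_map_leaf (K := K) As).1
        simp only [dep_cons, h₂] at h₁
        simp at h₁
      · exact ⟨l, k, As.map leaf, r, by simp [e], bal_map_leaf As⟩
      · exact ih (l ++ op k :: As.map leaf) j r (by simp at hv; omega) (by simp [e])
  rcases noOp w with h' | ⟨As, r, rfl⟩ | ⟨As, k, r, rfl⟩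
  · exact .inl h'
  · exact absurd (h.of_append_left (bal_map_leaf As)) not_bal_cl
  · exact .inr (afterOp _ (As.map leaf) k r le_rfl rfl)

end Leaves

lemma exists_of_relabel_eq_map_leaf {ι κ : Type} {f : ι → κ} {w : List (LSym ι)} :
    ∀ {As : List (LTp κ)}, relabel f w = As.map leaf →
      ∃ Bs : List (LTp ι), w = Bs.map leaf ∧ Bs.map (LTp.map f) = As := by
  induction w with
  | nil =>
    intro As e
    exact ⟨[], rfl, by simpa using e⟩
  | cons s w ih =>
    intro As e
    rcases As with _ | ⟨A, As⟩
    · simp at e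
    · obtain ⟨B, r, e₁, rfl, e₂⟩ := relabel_eq_cons_leaf (r := As.map leaf) (B := A) e
      simp at e₁
      obtain ⟨rfl, rfl⟩ := e₁
      obtain ⟨Bs, rfl, rfl⟩ := ih e₂
      exact ⟨B :: Bs, rfl, rfl⟩

end LDiamond

namespace LDiamond

open LDiamond.Sym

/-! ### The context-free grammar -/

section Grammar

variable {α : Type*}

/-- The rules of the context-free grammar whose nonterminals are the bounded types: the rules
`C → A`, `C → A B` and `C → A` for derivable sequents `A ⇒ C`, `A B ⇒ C` and `⟨A⟩ ⇒ C`, and the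
rules given by the lexicon. Brackets leave no trace in the derived strings. -/
inductive IsRule (m : ℕ) (Q : Finset ℕ) (lex : Finset (α × Tp)) :
    ContextFreeRule α (LTp ℕ) → Prop where
  | unary {A C : LTp ℕ} : Bounded m Q A → Bounded m Q C → CF [leaf A] C →
      IsRule m Q lex ⟨C, [.nonterminal A]⟩
  | binary {A B C : LTp ℕ} : Bounded m Q A → Bounded m Q B → Bounded m Q C →
      CF [leaf A, leaf B] C → IsRule m Q lex ⟨C, [.nonterminal A, .nonterminal B]⟩
  | bracket {k : ℕ} {A C : LTp ℕ} : Bounded m Q A → Bounded m Q C → CF [op k, leaf A, cl] C →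
      IsRule m Q lex ⟨C, [.nonterminal A]⟩
  | lexical {a : α} {A : Tp} : (a, A) ∈ lex → IsRule m Q lex ⟨A.emb, [.terminal a]⟩

lemma finite_isRule (m : ℕ) (Q : Finset ℕ) (lex : Finset (α × Tp)) :
    {r | IsRule m Q lex r}.Finite := by
  have hS := finite_bounded m Q
  refine Set.Finite.subset
    ((Set.Finite.image2 (fun A C => (⟨C, [.nonterminal A]⟩ : ContextFreeRule α (LTp ℕ)))
      hS hS).union ((Set.Finite.image2
        (fun (p : LTp ℕ × LTp ℕ) C =>
          (⟨C, [.nonterminal p.1, .nonterminal p.2]⟩ : ContextFreeRule α (LTp ℕ)))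
        (hS.prod hS) hS).union
      (lex.finite_toSet.image fun p => (⟨p.2.emb, [.terminal p.1]⟩ : ContextFreeRule α (LTp ℕ)))))
    ?_
  rintro _ (⟨hA, hC, -⟩ | ⟨hA, hB, hC, -⟩ | ⟨hA, hC, -⟩ | h)
  · exact .inl ⟨_, hA, _, hC, rfl⟩
  · exact .inr (.inl ⟨(_, _), ⟨hA, hB⟩, _, hC, rfl⟩)
  · exact .inl ⟨_, hA, _, hC, rfl⟩
  · exact .inr (.inr ⟨_, h, rfl⟩)

/-- The context-free grammar on bounded types with the given lexicon and goal type. -/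
noncomputable def gram (m : ℕ) (Q : Finset ℕ) (lex : Finset (α × Tp)) (D : Tp) :
    ContextFreeGrammar α where
  NT := LTp ℕ
  initial := D.emb
  rules := (finite_isRule m Q lex).toFinset

variable {m : ℕ} {Q : Finset ℕ} {lex : Finset (α × Tp)} {D : Tp}

/-- The sentential form consisting of the given nonterminals. -/
def ntForm (α : Type*) (As : List (LTp ℕ)) : List (Symbol α (LTp ℕ)) := As.map .nonterminal

@[simp] lemma ntForm_nil : ntForm α [] = [] := rfl
@[simp] lemma ntForm_cons (A : LTp ℕ) (As : List (LTp ℕ)) :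
    ntForm α (A :: As) = .nonterminal A :: ntForm α As := rfl
@[simp] lemma ntForm_append (As Bs : List (LTp ℕ)) :
    ntForm α (As ++ Bs) = ntForm α As ++ ntForm α Bs := by simp [ntForm]

/-- Derivability of a sentential form from a nonterminal in the grammar on bounded types. -/
def Gen (m : ℕ) (Q : Finset ℕ) (lex : Finset (α × Tp)) (D : Tp) (C : LTp ℕ)
    (v : List (Symbol α (LTp ℕ))) : Prop :=
  (gram m Q lex D).Derives [.nonterminal C] v

lemma Gen.subst {C E : LTp ℕ} {u p q : List (Symbol α (LTp ℕ))}
    (h₁ : Gen m Q lex D C (p ++ .nonterminal E :: q)) (h₂ : Gen m Q lex D E u) :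
    Gen m Q lex D C (p ++ (u ++ q)) := by
  refine ContextFreeGrammar.Derives.trans h₁ ?_
  exact (ContextFreeGrammar.Derives.append_right h₂ q).append_left p

lemma Gen.of_rule {C : LTp ℕ} {v : List (Symbol α (LTp ℕ))} (h : IsRule m Q lex ⟨C, v⟩) :
    Gen m Q lex D C v :=
  ContextFreeGrammar.Produces.single
    ⟨⟨C, v⟩, (finite_isRule m Q lex).mem_toFinset.2 h, ContextFreeRule.Rewrites.input_output⟩

lemma Gen.of_rule_unary {C E : LTp ℕ} {v : List (Symbol α (LTp ℕ))}
    (h : IsRule m Q lex ⟨C, [.nonterminal E]⟩) (hE : Gen m Q lex D E v) :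
    Gen m Q lex D C v := by
  simpa using Gen.subst (p := []) (q := []) (Gen.of_rule h) hE

lemma wordVal_map_leaf {ι : Type} (As : List (LTp ι)) :
    wordVal (As.map leaf) = (As.map LTp.val).prod := by
  induction As with
  | nil => rfl
  | cons A As ih => simp [ih]

lemma exists_of_wordCnt_pos {ι : Type} [DecidableEq ι] {x : ι} {As : List (LTp ι)}
    (h : 0 < wordCnt x (As.map leaf)) : ∃ A ∈ As, x ∈ A.labs := by
  induction As with
  | nil => simp at h
  | cons A As ih =>
    rcases Nat.eq_zero_or_pos (A.cnt x) with h₀ | h₀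
    · obtain ⟨B, hB, hx⟩ := ih (by simpa [h₀] using h)
      exact ⟨B, by simp [hB], hx⟩
    · exact ⟨A, by simp, Multiset.count_pos.1 h₀⟩

/-- The boundedness of the type underlying a type over `ℕ × ℕ`. -/
def Bounded₂ (m : ℕ) (Q : Finset ℕ) (A : LTp (ℕ × ℕ)) : Prop :=
  A.size ≤ m ∧ ∀ x ∈ A.labs, x.1 ∈ Q

lemma bounded_map_iff {A : LTp (ℕ × ℕ)} : Bounded m Q (A.map Prod.fst) ↔ Bounded₂ m Q A := by
  simp [Bounded, Bounded₂, LTp.size, LTp.labs_map]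

/-- In a thin sequent without brackets, an interpolant of a segment whose interpretation has norm
at most `m` is bounded. -/
lemma IsInterpolant.bounded {l r : List (LSym (ℕ × ℕ))} {As : List (LTp (ℕ × ℕ))}
    {C E : LTp (ℕ × ℕ)} (h : IsInterpolant l (As.map leaf) r C E)
    (ht : Thin (l ++ (As.map leaf ++ r)) C) (hQ : ∀ A ∈ As, Bounded₂ m Q A)
    (hm : (As.map LTp.val).prod.norm ≤ m) : Bounded₂ m Q E := by
  refine ⟨le_trans (LTp.size_le_norm_val fun x => ?_) ?_, fun x hx => ?_⟩
  · have h₁ := h.cnt_le x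
    have h₂ := h.cnt_le_rest x
    have h₃ := ht x
    simp at h₃
    omega
  · rwa [← h.proves.wordVal_eq, wordVal_map_leaf]
  · obtain ⟨A, hA, hx'⟩ := exists_of_wordCnt_pos
      ((Multiset.count_pos.2 hx).trans_le (h.cnt_le x))
    exact (hQ A hA).2 x hx'

lemma IsInterpolant.thin_proves {ι : Type} [DecidableEq ι] {l w r : List (LSym ι)} {C E : LTp ι}
    (h : IsInterpolant l w r C E) (ht : Thin (l ++ (w ++ r)) C) : Thin w E := fun x => by
  have h₁ := h.cnt_le x
  have h₂ := h.cnt_le_rest x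
  have h₃ := ht x
  simp at h₃
  omega

lemma IsInterpolant.thin_replace {ι : Type} [DecidableEq ι] {l w r : List (LSym ι)} {C E : LTp ι}
    (h : IsInterpolant l w r C E) (ht : Thin (l ++ (w ++ r)) C) :
    Thin (l ++ leaf E :: r) C := fun x => by
  have h₁ := h.cnt_le x
  have h₃ := ht x
  simp at h₃ ⊢
  omega

/-- A thin derivable sequent of bounded types without brackets is derivable in the grammar: by the
four-point condition there are two adjacent types, or a proper initial segment, with a bounded
interpolant. -/
theorem Gen.of_thin : ∀ (n : ℕ) {As : List (LTp (ℕ × ℕ))} {C : LTp (ℕ × ℕ)}, As.length ≤ n →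
    CF (As.map leaf) C → Thin (As.map leaf) C → (∀ A ∈ As, Bounded₂ m Q A) → Bounded₂ m Q C →
      Gen m Q lex D (C.map Prod.fst) (ntForm α (As.map (LTp.map Prod.fst))) := by
  intro n
  induction n with
  | zero =>
    intro As C hn h
    obtain rfl : As = [] := by simpa using hn
    exact absurd rfl h.ne_nil
  | succ n ih =>
    intro As C hn h ht hAs hC
    have hne : As ≠ [] := by
      rintro rfl
      exact h.ne_nil rfl
    have hval : (As.map LTp.val).prod = C.val := by rw [← wordVal_map_leaf, h.wordVal_eq]
    rcases exists_adjacent_norm_le LTp.val As hne with ⟨As, Z, rfl, hle⟩ | ⟨X, A, B, Y, rfl, hle⟩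
    · rcases eq_or_ne As [] with rfl | hne'
      · refine Gen.of_rule (.unary (bounded_map_iff.2 (hAs Z (by simp))) (bounded_map_iff.2 hC) ?_)
        exact h.map Prod.fst
      · rw [List.map_append] at h ht
        obtain ⟨E, hE⟩ := h.exists_interpolant (l := []) rfl (bal_map_leaf As) (by simpa using hne')
        have hEb : Bounded₂ m Q E := hE.bounded ht (fun A hA => hAs A (by simp [hA]))
          (hle.trans (by rw [hval]; exact C.norm_val_le.trans hC.1))
        have h₁ := ih (by simp at hn; omega) hE.proves (hE.thin_proves ht)
          (fun A hA => hAs A (by simp [hA])) hEb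
        have h₂ := Gen.of_rule (lex := lex) (D := D) (.binary (bounded_map_iff.2 hEb)
          (bounded_map_iff.2 (hAs Z (by simp))) (bounded_map_iff.2 hC) (hE.replace.map Prod.fst))
        simpa using Gen.subst (p := []) h₂ h₁
    · have e : (X ++ A :: B :: Y).map leaf =
          X.map (leaf (K := ℕ × ℕ)) ++ ([A, B].map leaf ++ Y.map leaf) := by simp
      rw [e] at h ht
      obtain ⟨E, hE⟩ := h.exists_interpolant rfl (bal_map_leaf [A, B]) (by simp)
      have hA := hAs A (by simp)
      have hB := hAs B (by simp)
      have hAB : ∀ A' ∈ [A, B], Bounded₂ m Q A' := by simp [hA, hB]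
      have hEb : Bounded₂ m Q E := hE.bounded ht hAB (by
        simpa using hle.trans (max_le (A.norm_val_le.trans hA.1) (B.norm_val_le.trans hB.1)))
      have h₁ := ih (As := X ++ E :: Y) (C := C) (by simp at hn ⊢; omega)
        (by simpa using hE.replace) (by simpa using hE.thin_replace ht)
        (fun A' hA' => by
          simp at hA'
          rcases hA' with hA' | rfl | hA'
          · exact hAs A' (by simp [hA'])
          · exact hEb
          · exact hAs A' (by simp [hA'])) hC
      have h₂ := Gen.of_rule (lex := lex) (D := D) (.binary (bounded_map_iff.2 hA)
        (bounded_map_iff.2 hB) (bounded_map_iff.2 hEb) (hE.proves.map Prod.fst))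
      simpa using Gen.subst (p := ntForm α (X.map (LTp.map Prod.fst)))
        (q := ntForm α (Y.map (LTp.map Prod.fst))) (by simpa using h₁) h₂

/-- A derivable sequent of bounded types is derivable in the grammar, after deletion of the
brackets. -/
theorem Gen.of_CF : ∀ (n : ℕ) {w : List (LSym ℕ)} {C : LTp ℕ}, w.length ≤ n → CF w C →
    TypesIn (Bounded m Q) w → Bounded m Q C → Gen m Q lex D C (ntForm α (leaves w)) := by
  intro n
  induction n with
  | zero =>
    intro w C hn h
    obtain rfl : w = [] := by simpa using hn
    exact absurd rfl h.ne_nil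
  | succ n ih =>
    intro w C hn h hT hC
    rcases h.bal.leaves_or_brackets with ⟨As, rfl⟩ | ⟨l, k, u, r, rfl, hu⟩
    · obtain ⟨w', C', h', e, rfl, ht⟩ := h.exists_thin
      obtain ⟨Bs, rfl, rfl⟩ := exists_of_relabel_eq_map_leaf e
      rw [leaves_map_leaf]
      refine Gen.of_thin _ le_rfl h' ht (fun B hB => bounded_map_iff.1 (hT _ ?_))
        (bounded_map_iff.1 hC)
      exact List.mem_map_of_mem (List.mem_map_of_mem hB)
    · obtain ⟨E, hE, hr⟩ := h.exists_bracketType (subClosed_bounded m Q) rfl hu hT hC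
      simp at hT hn
      obtain ⟨hT₁, hT₂, hT₃⟩ := hT
      have key : Bounded m Q E ∧ Gen m Q lex D E (ntForm α (leaves u)) := by
        rcases hE with ⟨A, rfl, hS, hA⟩ | ⟨hS, hA⟩
        · have hbA := (subClosed_bounded m Q).dia hS
          exact ⟨hS, Gen.of_rule_unary (.bracket hbA hS (CF.diaR (CF.id A)))
            (ih (by omega) hA hT₂ hbA)⟩
        · have hbE := (subClosed_bounded m Q).box hS
          exact ⟨hbE, Gen.of_rule_unary
            (.bracket hS hbE (CF.boxL (l := []) (r := []) (CF.id E))) (ih (by omega) hA hT₂ hS)⟩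
      have h₁ := ih (w := l ++ leaf E :: r) (by simp; omega) hr (by simp [hT₁, hT₃, key.1]) hC
      simpa using Gen.subst (p := ntForm α (leaves l)) (q := ntForm α (leaves r))
        (by simpa using h₁) key.2

mutual
lemma Tree.leaves_flat : ∀ T : Tree, leaves T.flat = T.yield
  | .leaf A => rfl
  | .brackets Γ => by simpa [Tree.flat, Tree.yield] using Hedge.leaves_flat Γ
lemma Hedge.leaves_flat : ∀ Γ : Hedge, leaves (Hedge.flat Γ) = Hedge.yield Γ
  | [] => rfl
  | T :: Γ => by simp [Hedge.flat, Hedge.yield, Tree.leaves_flat T, Hedge.leaves_flat Γ]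
end

lemma Hedge.exists_context_of_yield {Γ : Hedge} {X Y : List Tp} {A : Tp}
    (e : Hedge.yield Γ = X ++ A :: Y) :
    ∃ Δ : Context, Γ = Δ.fill (Hedge.single A) ∧
      ∀ Γ' : Hedge, Hedge.yield (Δ.fill Γ') = X ++ (Hedge.yield Γ' ++ Y) := by
  rw [← Hedge.leaves_flat] at e
  obtain ⟨l, r, e', rfl, rfl⟩ := exists_of_leaves_eq_append_cons e
  obtain ⟨Δ, h, H⟩ := Hedge.exists_context (Hedge.single A) Γ (l := l) (r := r)
    (by simpa [Hedge.flat, Tree.flat] using e')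
  exact ⟨Δ, h, fun Γ' => by rw [← Hedge.leaves_flat, H]; simp [Hedge.leaves_flat]⟩

lemma Provable.id (A : Tp) : Provable (Hedge.single A) A := by
  obtain ⟨Γ, e, h⟩ := (CF.id A.emb).exists_provable
  rw [LTp.forget_emb] at h
  obtain rfl : Γ = Hedge.single A :=
    Hedge.flat_injective (e.trans (by simp [Hedge.flat, Tree.flat, LTp.forget_emb]))
  exact h

lemma mem_leaves {T K : Type} {A : T} {w : List (Sym T K)} (h : leaf A ∈ w) : A ∈ leaves w := by
  obtain ⟨u, v, rfl⟩ := List.append_of_mem h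
  simp

lemma forall₂_append_left {β γ : Type*} {R : β → γ → Prop} {p q : List β} {z : List γ}
    (h : List.Forall₂ R (p ++ q) z) :
    ∃ x y, List.Forall₂ R p x ∧ List.Forall₂ R q y ∧ z = x ++ y := by
  induction p generalizing z with
  | nil => exact ⟨[], z, .nil, h, rfl⟩
  | cons b p ih =>
    obtain _ | ⟨hb, h⟩ := h
    obtain ⟨x, y, hx, hy, rfl⟩ := ih h
    exact ⟨_ :: x, y, .cons hb hx, hy, rfl⟩

lemma exists_of_forall₂ {β γ : Type*} {R : β → γ → Prop} {x : List β} {y : List γ}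
    (h : List.Forall₂ R x y) {c : γ} (hc : c ∈ y) : ∃ b, R b c := by
  obtain ⟨y₁, y₂, rfl⟩ := List.append_of_mem hc
  obtain ⟨_, _, -, h, -⟩ := forall₂_append_left h.flip
  obtain _ | ⟨h, -⟩ := h
  exact ⟨_, h⟩

/-- The relation between the symbols of sentential forms and the types they stand for. -/
def Stands (lex : Finset (α × Tp)) : Symbol α (LTp ℕ) → Tp → Prop
  | .nonterminal B, A => B.forget = A
  | .terminal a, A => (a, A) ∈ lex

lemma forall₂_stands_ntForm (As : List (LTp ℕ)) :
    List.Forall₂ (Stands lex) (ntForm α As) (As.map LTp.forget) := by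
  induction As with
  | nil => exact .nil
  | cons A As ih => exact .cons rfl ih

/-- Every sentential form derivable in the grammar is witnessed by a provable sequent. -/
lemma Gen.exists_provable {C : LTp ℕ} {v : List (Symbol α (LTp ℕ))} (h : Gen m Q lex D C v) :
    ∃ Γ : Hedge, Provable Γ C.forget ∧ List.Forall₂ (Stands lex) v (Hedge.yield Γ) := by
  have ofCF : ∀ {w : List (LSym ℕ)} {B : LTp ℕ}, CF w B → ∃ Γ : Hedge, Provable Γ B.forget ∧
      List.Forall₂ (Stands lex) (ntForm α (leaves w)) (Hedge.yield Γ) := by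
    intro w B hB
    obtain ⟨Γ, e, hΓ⟩ := hB.exists_provable
    refine ⟨Γ, hΓ, ?_⟩
    rw [← Hedge.leaves_flat, e, leaves_map]
    exact forall₂_stands_ntForm _
  induction h with
  | refl => exact ofCF (CF.id C)
  | @tail v v' _ hstep ih =>
    obtain ⟨Γ, hΓ, hv⟩ := ih
    obtain ⟨ρ, hρ, hrw⟩ := hstep
    obtain ⟨p, q, rfl, rfl⟩ := hrw.exists_parts
    replace hρ : IsRule m Q lex ρ := (finite_isRule m Q lex).mem_toFinset.1 hρ
    rw [List.append_assoc] at hv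
    obtain ⟨X, Y', hX, hY', e⟩ := forall₂_append_left hv
    rw [List.singleton_append] at hY'
    obtain _ | @⟨_, A, _, Y, hA, hY⟩ := hY'
    obtain rfl : ρ.input.forget = A := hA
    obtain ⟨Δ, rfl, hΔ⟩ := Hedge.exists_context_of_yield e
    -- It suffices to replace the type by the antecedent of a provable sequent, using the cut rule.
    have cut : (∃ Γ' : Hedge, Provable Γ' ρ.input.forget ∧
        List.Forall₂ (Stands lex) ρ.output (Hedge.yield Γ')) →
        ∃ Γ : Hedge, Provable Γ C.forget ∧
          List.Forall₂ (Stands lex) (p ++ ρ.output ++ q) (Hedge.yield Γ) := by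
      rintro ⟨Γ', h₁, h₂⟩
      refine ⟨Δ.fill Γ', .cut h₁ hΓ, ?_⟩
      rw [hΔ, List.append_assoc]
      exact List.rel_append hX (List.rel_append h₂ hY)
    apply cut
    rcases hρ with ⟨-, -, h⟩ | ⟨-, -, -, h⟩ | ⟨-, -, h⟩ | @⟨a, A, h⟩
    · exact ofCF h
    · exact ofCF h
    · exact ofCF h
    · refine ⟨Hedge.single A, ?_, .cons h .nil⟩
      rw [LTp.forget_emb]
      exact Provable.id A

/-- A string of lexical types can be replaced by the corresponding letters. -/
lemma Gen.terminals {C : LTp ℕ} {w : List α} {As : List Tp}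
    (h : List.Forall₂ (fun a A => (a, A) ∈ lex) w As) :
    ∀ {u : List (Symbol α (LTp ℕ))}, Gen m Q lex D C (u ++ ntForm α (As.map Tp.emb)) →
      Gen m Q lex D C (u ++ w.map .terminal) := by
  induction h with
  | nil => exact fun h => h
  | @cons a A w As ha _ ih =>
    intro u hu
    have h : Gen m Q lex D C ((u ++ [.terminal a]) ++ ntForm α (As.map Tp.emb)) := by
      rw [List.append_assoc]
      exact Gen.subst hu (Gen.of_rule (.lexical ha))
    have h' := ih h
    rwa [List.append_assoc] at h'

lemma exists_bounded (lex : Finset (α × Tp)) (D : Tp) :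
    ∃ (m : ℕ) (Q : Finset ℕ), Bounded m Q D.emb ∧ ∀ p ∈ lex, Bounded m Q p.2.emb := by
  refine ⟨D.emb.size + ∑ p ∈ lex, p.2.emb.size,
    D.emb.labs.toFinset ∪ lex.biUnion fun p => p.2.emb.labs.toFinset,
    ⟨Nat.le_add_right _ _, fun x hx => by simp [hx]⟩, fun p hp => ⟨?_, fun x hx => ?_⟩⟩
  · exact (Finset.single_le_sum (f := fun p : α × Tp => p.2.emb.size) (by simp) hp).trans
      (Nat.le_add_left _ _)
  · exact Finset.mem_union_right _ (Finset.mem_biUnion.2 ⟨p, hp, by simpa using hx⟩)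

/-- If the types of the lexicon and the goal type are bounded, then the grammar on bounded types
generates the language of the Lambek grammar. -/
theorem gram_language (hD : Bounded m Q D.emb) (hlex : ∀ p ∈ lex, Bounded m Q p.2.emb) :
    (gram m Q lex D).language = Grammar.language ⟨lex, D⟩ := by
  ext w
  constructor
  · intro h
    obtain ⟨Γ, hΓ, hw⟩ := Gen.exists_provable (C := D.emb) h
    rw [LTp.forget_emb] at hΓ
    exact ⟨Γ, hΓ, List.forall₂_map_left_iff.1 hw⟩
  · rintro ⟨Γ, hΓ, hw⟩
    have hT : TypesIn (Bounded m Q) (embWord (Hedge.flat Γ)) := by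
      intro A hA
      have hA' := mem_leaves hA
      rw [leaves_map, Hedge.leaves_flat] at hA'
      obtain ⟨B, hB, rfl⟩ := List.mem_map.1 hA'
      obtain ⟨a, ha⟩ := exists_of_forall₂ hw hB
      exact hlex _ ha
    have h := Gen.of_CF (lex := lex) (D := D) _ le_rfl hΓ.toCF hT hD
    rw [leaves_map, Hedge.leaves_flat] at h
    exact Gen.terminals hw (u := []) h

end Grammar

end LDiamond

theorem mainTheorem1 {α : Type*} [Finite α] (L : Language α) (hL : LDiamond.Recognized L) :
    L.IsContextFree := by
  obtain ⟨⟨lex, D⟩, rfl⟩ := hL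
  obtain ⟨m, Q, hD, hlex⟩ := LDiamond.exists_bounded lex D
  exact ⟨LDiamond.gram m Q lex D, LDiamond.gram_language hD hlex⟩
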